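/- Let $d \ge 2$ and let $\mathcal{S}^d \subseteq \mathbb{R}^{d+1}$ be the unit hypersphere with its round metric, of surface area $A_{\mathcal{S}^d}$. Let $\nu(t,x,y)$, $t>0$, be the heat kernel of $\mathcal{S}^d$ (the transition density of Brownian motion), i.e. the minimal nonnegative solution of $\partial_t \nu = \frac12 \Delta_y \nu$ with $\nu(0,x,\cdot)=\delta_x$. For $L \in \mathbb{N}$ let $$\nu_L(t,x,y) = \sum_{k=0}^{L} e^{-k(k+d-1)t/2}\, \frac{2k+d-1}{(d-1)A_{\mathcal{S}^d}}\, C_k^{(d-1)/2}\big(\langle x,y\rangle_{\mathbb{R}^{d+1}}\big)$$ be the truncation at level $L$ of its Gegenbauer series, where $C_k^{\alpha}$ are the Gegenbauer polynomials. Write $f(\varepsilon)=\tilde{\mathcal{O}}(g(\varepsilon))$ if $f(\varepsilon) = \mathcal{O}\big(g(\varepsilon)\log^m\frac1\varepsilon\big)$ as $\varepsilon \to 0^+$ for some $m \in \mathbb{N}$, where the constants may depend on all parameters other than $\varepsilon$. Let $\zeta = \zeta(\varepsilon) = \varepsilon/\log^2\frac1\varepsilon$, and let $\eta=\eta(\varepsilon)>0$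 be a step size with $\frac1\eta = \tilde{\mathcal{O}}(\log\frac1\varepsilon)$. Then there is a truncation level $L = L(\varepsilon) \in \mathbb{N}$ with $L = \tilde{\mathcal{O}}(\mathrm{Poly}(\log\frac1\varepsilon))$ such that $$\sup_{x,y\in\mathcal{S}^d} |\nu(\eta,x,y)-\nu_L(\eta,x,y)| = \tilde{\mathcal{O}}(\zeta).$$ -/

import Mathlib

open Set Filter Topology MeasureTheory
open scoped InnerProductSpace

namespace SphereHeat

/-- The unit hypersphere `S^d` in `ℝ^(d+1)` with its Euclidean norm. -/
abbrev Sphere (d : ℕ) : Type := Metric.sphere (0 : EuclideanSpace ℝ (Fin (d + 1))) 1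

/-- The Riemannian volume (surface area) measure of `S^d`. -/
noncomputable def surface (d : ℕ) : Measure (Sphere d) :=
  (volume : Measure (EuclideanSpace ℝ (Fin (d + 1)))).toSphere

/-- The surface area of `S^d`. -/
noncomputable def area (d : ℕ) : ℝ := (surface d).real univ

/-- The extension of a function on `S^d` that is constant along rays, `z ↦ f (z / ‖z‖)`
(with the value `0` at the origin, which plays no role). -/
noncomputable def radialExt {d : ℕ} (f : Sphere d → ℝ) (z : EuclideanSpace ℝ (Fin (d + 1))) : ℝ :=
  if hz : z = 0 then 0
  else f ⟨‖z‖⁻¹ • z, by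
    rw [mem_sphere_zero_iff_norm, norm_smul, norm_inv, norm_norm,
      inv_mul_cancel₀ (norm_ne_zero_iff.mpr hz)]⟩

/-- `f` is twice continuously differentiable on `S^d`. -/
def IsC2 {d : ℕ} (f : Sphere d → ℝ) : Prop := ContDiffOn ℝ 2 (radialExt f) {0}ᶜ

/-- The Laplace-Beltrami operator of the round unit sphere: the restriction to the sphere of the
Euclidean Laplacian of the extension that is constant along rays. -/
noncomputable def sphereLaplacian {d : ℕ} (f : Sphere d → ℝ) (x : Sphere d) : ℝ :=
  Laplacian.laplacian (radialExt f) (x : EuclideanSpace ℝ (Fin (d + 1)))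

/-- `q t x y` (for `t > 0`) is a nonnegative classical solution of the heat equation
`∂ₜ q = (1/2) Δ_y q` on `S^d` with initial condition `q 0 x = δ_x`. -/
structure IsFundamentalSolution (d : ℕ) (q : ℝ → Sphere d → Sphere d → ℝ) : Prop where
  nonneg : ∀ t : ℝ, 0 < t → ∀ x y, 0 ≤ q t x y
  cont : ∀ x, ContinuousOn (fun p : ℝ × Sphere d => q p.1 x p.2) (Ioi 0 ×ˢ univ)
  smooth : ∀ t : ℝ, 0 < t → ∀ x, IsC2 (fun y => q t x y)
  cont_laplacian : ∀ x,
    ContinuousOn (fun p : ℝ × Sphere d => sphereLaplacian (fun y => q p.1 x y) p.2) (Ioi 0 ×ˢ univ)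
  heat_eq : ∀ t : ℝ, 0 < t → ∀ x y,
    HasDerivAt (fun s => q s x y) ((1 / 2) * sphereLaplacian (fun z => q t x z) y) t
  initial : ∀ x, ∀ f : C(Sphere d, ℝ),
    Tendsto (fun t => ∫ y, q t x y * f y ∂(surface d)) (𝓝[>] 0) (𝓝 (f x))

/-- `ν` is the heat kernel of `S^d`, i.e. the transition density of its Brownian motion: the minimal
nonnegative solution of `∂ₜ ν = (1/2) Δ_y ν`, `ν 0 x = δ_x`. -/
structure IsHeatKernel (d : ℕ) (ν : ℝ → Sphere d → Sphere d → ℝ) : Prop where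
  solution : IsFundamentalSolution d ν
  minimal : ∀ q, IsFundamentalSolution d q → ∀ t : ℝ, 0 < t → ∀ x y, ν t x y ≤ q t x y

/-- The Gegenbauer polynomials `C_k^α`, by their three-term recurrence. -/
noncomputable def gegenbauer (α : ℝ) : ℕ → Polynomial ℝ
  | 0 => 1
  | 1 => Polynomial.C (2 * α) * Polynomial.X
  | n + 2 =>
      Polynomial.C (1 / ((n : ℝ) + 2)) *
        (Polynomial.C (2 * ((n : ℝ) + 1 + α)) * Polynomial.X * gegenbauer α (n + 1)
          - Polynomial.C ((n : ℝ) + 2 * α) * gegenbauer α n)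

/-- The truncation at level `L` of the Gegenbauer series of the heat kernel of `S^d`, `d ≥ 2`:
`∑_{k ≤ L} exp (-k (k+d-1) t / 2) (2k+d-1) / ((d-1) A) C_k^((d-1)/2) (⟨x, y⟩)`,
where `A` is the area of `S^d`. -/
noncomputable def truncatedKernel (d L : ℕ) (t : ℝ) (x y : Sphere d) : ℝ :=
  ∑ k ∈ Finset.range (L + 1),
    Real.exp (-((k : ℝ) * ((k : ℝ) + (d : ℝ) - 1) * t) / 2) *
      ((2 * (k : ℝ) + (d : ℝ) - 1) / (((d : ℝ) - 1) * area d)) *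
      (gegenbauer (((d : ℝ) - 1) / 2) k).eval
        ⟪(x : EuclideanSpace ℝ (Fin (d + 1))), (y : EuclideanSpace ℝ (Fin (d + 1)))⟫_ℝ

/-- `f = Õ(g)` as `ε → 0+`: big-O up to a power of `log (1 / ε)`. -/
def IsSoftO (f g : ℝ → ℝ) : Prop :=
  ∃ k : ℕ, f =O[𝓝[>] 0] fun ε => g ε * Real.log (1 / ε) ^ k

/-- The oracle accuracy `ζ = ε / log² (1 / ε)`. -/
noncomputable def zeta (ε : ℝ) : ℝ := ε / Real.log (1 / ε) ^ 2

end SphereHeat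

/-!
The only fundamental solution of the heat equation on `S^d` is the Gegenbauer series, and the
remainder of that series beyond level `L` is at most a constant times `exp (-L)` once `L t ≥ 4`.
At `t = η`, a level `L` of the order of `log (1 / ε)` plus the given bound on `1 / η` then makes the
truncation error `O(ε)`.

*Moments.* Green's identity `integral_mul_sphereLaplacian_comm` says that the Laplace-Beltrami
operator is symmetric. It is obtained in Euclidean space, for functions constant along rays, by
integrating by parts against a radial cutoff; the gradient of the cutoff is orthogonal to those of
the two functions, so no boundary term survives. The zonal function `C_k (⟨z, ·⟩)` is an
eigenfunction by the Gegenbauer differential equation (`sphereLaplacian_zonalGegenbauer`), so its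
integral against a fundamental solution `q t x` solves a linear ordinary differential equation
with initial value `C_k (⟨z, x⟩)` (`IsFundamentalSolution.integral_mul_zonalGegenbauer`).

*Peak functions.* The functions `((1 + ⟨z, ·⟩) / 2) ^ n`, once normalized, converge to the Dirac
mass at `z`, and each of them is a finite combination of zonal Gegenbauer functions. Testing them
against `C_k (⟨z, ·⟩)` and using orthogonality identifies the limits of their normalized
coefficients (`tendsto_peakCoeff`). Testing against `C_k (⟨x, ·⟩)` and applying the Cauchy-Schwarz
inequality gives `|C_k| ≤ C_k 1` on `[-1, 1]` (`abs_zonalGegenbauer_le`), which in turn bounds the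
coefficients uniformly in `n` (`abs_peakCoeff_le`). Neither the addition theorem for spherical
harmonics nor the completeness of these functions is needed.

*Series.* Testing the peak functions against `q t x` recovers `q t x z` in the limit, while the
moments turn the integrals into finite sums dominated by a convergent series; Tannery's theorem
gives `IsFundamentalSolution.eq_tsum`.
-/

namespace SphereHeat

/-! ### Green's identity on the sphere -/

section RadialCutoff

variable {E : Type*} [NormedAddCommGroup E]

/-- A smooth bump function of one real variable, supported in `[1/2, 3/2]`. -/
noncomputable def profile : ContDiffBump (1 : ℝ) := ⟨1 / 4, 1 / 2, by norm_num, by norm_num⟩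

/-- A smooth radial cutoff function, compactly supported away from the origin. -/
noncomputable def cutoff (y : E) : ℝ := profile (‖y‖ ^ 2)

lemma cutoff_nonneg (y : E) : 0 ≤ cutoff y := profile.nonneg

lemma tsupport_cutoff_subset :
    tsupport (cutoff : E → ℝ) ⊆ {y : E | 1 / 2 ≤ ‖y‖ ^ 2 ∧ ‖y‖ ^ 2 ≤ 3 / 2} := by
  refine closure_minimal ?_ ?_
  · intro y hy
    have h : ‖y‖ ^ 2 ∈ Function.support profile := hy
    rw [profile.support_eq, Metric.mem_ball, Real.dist_eq, abs_lt] at h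
    simp only [profile] at h
    constructor <;> linarith [h.1, h.2]
  · exact (isClosed_le continuous_const (continuous_norm.pow 2)).inter
      (isClosed_le (continuous_norm.pow 2) continuous_const)

lemma tsupport_cutoff_subset_compl : tsupport (cutoff : E → ℝ) ⊆ {0}ᶜ := by
  intro y hy h0
  have := (tsupport_cutoff_subset hy).1
  rw [mem_singleton_iff.1 h0] at this
  norm_num at this

lemma hasCompactSupport_cutoff [ProperSpace E] : HasCompactSupport (cutoff : E → ℝ) := by
  refine HasCompactSupport.of_support_subset_isCompact (isCompact_closedBall (0 : E) 2) ?_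
  intro y hy
  have := (tsupport_cutoff_subset (subset_tsupport _ hy)).2
  rw [mem_closedBall_zero_iff]
  nlinarith [norm_nonneg y]

variable [InnerProductSpace ℝ E]

lemma contDiff_cutoff : ContDiff ℝ 1 (cutoff : E → ℝ) :=
  profile.contDiff.comp (contDiff_norm_sq ℝ)

lemma fderiv_cutoff (y e : E) :
    fderiv ℝ cutoff y e = deriv profile (‖y‖ ^ 2) * (2 * ⟪y, e⟫_ℝ) := by
  have h1 : HasDerivAt profile (deriv profile (‖y‖ ^ 2)) (‖y‖ ^ 2) :=
    ((profile.contDiff (n := 1)).differentiable one_ne_zero _).hasDerivAt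
  have h2 : HasFDerivAt (fun y : E => ‖y‖ ^ 2) (2 • innerSL ℝ y) y :=
    (hasStrictFDerivAt_norm_sq y).hasFDerivAt
  have h3 := h1.comp_hasFDerivAt y h2
  have h4 : fderiv ℝ cutoff y = deriv profile (‖y‖ ^ 2) • (2 • innerSL ℝ y) := h3.fderiv
  rw [h4]
  simp

lemma cutoff_mul_continuous {K : E → ℝ} (hK : ContinuousOn K {0}ᶜ) :
    Continuous fun y => cutoff y * K y := by
  refine continuous_of_tsupport fun y hy => ?_
  have hy0 : y ∈ ({0}ᶜ : Set E) := tsupport_cutoff_subset_compl (tsupport_mul_subset_left hy)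
  exact (contDiff_cutoff.continuous.continuousAt).mul
    (hK.continuousAt (isOpen_compl_singleton.mem_nhds hy0))

lemma cutoff_mul_integrable [FiniteDimensional ℝ E] [MeasurableSpace E] [BorelSpace E]
    (μ : Measure E) [IsFiniteMeasureOnCompacts μ] {K : E → ℝ} (hK : ContinuousOn K {0}ᶜ) :
    Integrable (fun y => cutoff y * K y) μ :=
  (cutoff_mul_continuous hK).integrable_of_hasCompactSupport
    (hasCompactSupport_cutoff.mul_right)

/-- In polar coordinates, the integral of a function homogeneous of degree `-2` against the radial
cutoff is a fixed nonzero multiple of its integral over the unit sphere. -/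
lemma exists_integral_cutoff_mul [FiniteDimensional ℝ E] [MeasurableSpace E] [BorelSpace E]
    (μ : Measure E) [μ.IsAddHaarMeasure] [Nontrivial E] :
    ∃ c : ℝ, c ≠ 0 ∧ ∀ K : E → ℝ,
      (∀ r : ℝ, 0 < r → ∀ y, y ≠ 0 → K (r • y) = (r ^ 2)⁻¹ * K y) →
      ∫ y, cutoff y * K y ∂μ = c * ∫ w, K w ∂μ.toSphere := by
  set c : ℝ := ∫ r : Ioi (0 : ℝ), (profile (r.1 ^ 2)) * (r.1 ^ 2)⁻¹
    ∂(Measure.volumeIoiPow (Module.finrank ℝ E - 1)) with hc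
  have key : ∀ K : E → ℝ,
      (∀ r : ℝ, 0 < r → ∀ y, y ≠ 0 → K (r • y) = (r ^ 2)⁻¹ * K y) →
      ∫ y, cutoff y * K y ∂μ = c * ∫ w, K w ∂μ.toSphere := by
    intro K hK
    calc ∫ y, cutoff y * K y ∂μ
        = ∫ y : ({(0)}ᶜ : Set E), cutoff y.1 * K y.1 ∂(μ.comap (↑)) := by
          rw [integral_subtype_comap (measurableSet_singleton _).compl
            fun y => cutoff y * K y, restrict_compl_singleton]
      _ = ∫ p, (K p.1 : ℝ) * ((profile (p.2.1 ^ 2)) * (p.2.1 ^ 2)⁻¹)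
            ∂μ.toSphere.prod (.volumeIoiPow (Module.finrank ℝ E - 1)) := by
          rw [← μ.measurePreserving_homeomorphUnitSphereProd.integral_comp
            (Homeomorph.measurableEmbedding _)]
          refine integral_congr_ae (Eventually.of_forall fun y => ?_)
          have hy : (y : E) ≠ 0 := y.2
          have hn : 0 < ‖(y : E)‖ := norm_pos_iff.2 hy
          have h := hK ‖(y : E)‖⁻¹ (inv_pos.2 hn) y.1 hy
          simp only [homeomorphUnitSphereProd_apply_fst_coe,
            homeomorphUnitSphereProd_apply_snd_coe]
          rw [h, cutoff]
          field_simp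
      _ = _ := by
          rw [hc, mul_comm]
          exact integral_prod_mul (fun w : Metric.sphere (0 : E) 1 => K w)
            (fun r : Ioi (0 : ℝ) => profile (r.1 ^ 2) * (r.1 ^ 2)⁻¹)
  -- The constant is nonzero because the integral of `‖y‖⁻²` against the cutoff is positive.
  refine ⟨c, ?_, key⟩
  intro hc0
  have hK : ContinuousOn (fun y : E => (‖y‖ ^ 2)⁻¹) {0}ᶜ := by
    refine ContinuousOn.inv₀ (by fun_prop) fun y hy => ?_
    simpa using hy
  have h0 := key (fun y => (‖y‖ ^ 2)⁻¹) (fun r hr y hy => by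
    rw [norm_smul, mul_pow, mul_inv, Real.norm_eq_abs, sq_abs])
  rw [hc0, zero_mul] at h0
  obtain ⟨v, hv⟩ := exists_norm_eq E zero_le_one
  have hpos : 0 < ∫ y, cutoff y * (‖y‖ ^ 2)⁻¹ ∂μ := by
    refine (cutoff_mul_continuous hK).integral_pos_of_hasCompactSupport_nonneg_nonzero
      hasCompactSupport_cutoff.mul_right
      (fun y => mul_nonneg (cutoff_nonneg y) (by positivity)) (x := v) ?_
    have : cutoff v = 1 := by
      rw [cutoff, hv, one_pow]
      exact profile.one_of_mem_closedBall (Metric.mem_closedBall_self profile.rIn_pos.le)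
    rw [this, hv]
    norm_num
  exact hpos.ne' h0

end RadialCutoff

section Green

variable {E : Type*} [NormedAddCommGroup E] [InnerProductSpace ℝ E]

/-- A function that is constant along rays: homogeneous of degree zero off the origin. -/
def IsRadiallyConstant (F : E → ℝ) : Prop := ∀ r : ℝ, 0 < r → ∀ y, F (r • y) = F y

/-- Euler's identity in degree zero. -/
lemma IsRadiallyConstant.fderiv_self {F : E → ℝ} (hF : IsRadiallyConstant F) {y : E}
    (hd : DifferentiableAt ℝ F y) : fderiv ℝ F y y = 0 := by
  have h1 : HasDerivAt (fun r : ℝ => r • y) y 1 := by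
    simpa using (hasDerivAt_id (1 : ℝ)).smul_const y
  have h2 : HasFDerivAt F (fderiv ℝ F y) ((1 : ℝ) • y) := by
    rw [one_smul]; exact hd.hasFDerivAt
  have h3 := h2.comp_hasDerivAt (1 : ℝ) h1
  have h4 : HasDerivAt (F ∘ fun r : ℝ => r • y) 0 1 := by
    refine (hasDerivAt_const (1 : ℝ) (F y)).congr_of_eventuallyEq ?_
    filter_upwards [lt_mem_nhds (zero_lt_one (α := ℝ))] with r hr using hF r hr y
  exact h3.unique h4

lemma contDiffOn_fderiv_apply {F : E → ℝ} (hF : ContDiffOn ℝ 2 F {0}ᶜ) (e : E) :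
    ContDiffOn ℝ 1 (fun y => fderiv ℝ F y e) {0}ᶜ :=
  (hF.fderiv_of_isOpen isOpen_compl_singleton (by norm_num)).clm_apply contDiffOn_const

variable [FiniteDimensional ℝ E]

lemma laplacian_eq_sum_fderiv_fderiv {ι : Type*} [Fintype ι] (b : OrthonormalBasis ι ℝ E)
    (F : E → ℝ) (y : E) :
    Laplacian.laplacian F y = ∑ i, fderiv ℝ (fderiv ℝ F) y (b i) (b i) := by
  rw [InnerProductSpace.laplacian_eq_iteratedFDeriv_orthonormalBasis F b]
  simp [iteratedFDeriv_two_apply]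

lemma laplacian_comp_smul (F : E → ℝ) (r : ℝ) (y : E) :
    Laplacian.laplacian (fun z => F (r • z)) y = r ^ 2 * Laplacian.laplacian F (r • y) := by
  have h1 : fderiv ℝ (fun z => F (r • z)) = fun y => r • fderiv ℝ F (r • y) :=
    funext fun y => fderiv_comp_smul (f := F) r
  rw [laplacian_eq_sum_fderiv_fderiv (stdOrthonormalBasis ℝ E),
    laplacian_eq_sum_fderiv_fderiv (stdOrthonormalBasis ℝ E), h1, Finset.mul_sum]
  refine Finset.sum_congr rfl fun i _ => ?_
  have h2 : fderiv ℝ (fun y => r • fderiv ℝ F (r • y)) y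
      = r • (r • fderiv ℝ (fderiv ℝ F) (r • y)) := by
    rw [← fderiv_comp_smul (f := fderiv ℝ F) r]
    exact congrFun (fderiv_const_smul_field (𝕜 := ℝ) (f := fun y => fderiv ℝ F (r • y)) r) y
  rw [h2]
  simp only [FunLike.coe_smul, Pi.smul_apply, smul_eq_mul]
  ring

lemma IsRadiallyConstant.laplacian_smul {F : E → ℝ} (hF : IsRadiallyConstant F) {r : ℝ}
    (hr : 0 < r) (y : E) :
    Laplacian.laplacian F (r • y) = (r ^ 2)⁻¹ * Laplacian.laplacian F y := by
  have h := laplacian_comp_smul F r y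
  rw [show (fun z => F (r • z)) = F from funext (hF r hr)] at h
  rw [h]
  field_simp

lemma continuousOn_laplacian {F : E → ℝ} (hF : ContDiffOn ℝ 2 F {0}ᶜ) :
    ContinuousOn (Laplacian.laplacian F) {0}ᶜ := by
  have h : Laplacian.laplacian F = fun y => ∑ i, fderiv ℝ (fderiv ℝ F) y
      (stdOrthonormalBasis ℝ E i) (stdOrthonormalBasis ℝ E i) :=
    funext fun y => laplacian_eq_sum_fderiv_fderiv _ F y
  rw [h]
  have h2 : ContDiffOn ℝ 0 (fderiv ℝ (fderiv ℝ F)) {0}ᶜ :=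
    (hF.fderiv_of_isOpen isOpen_compl_singleton (m := 1) (by norm_num)).fderiv_of_isOpen
      isOpen_compl_singleton (by norm_num)
  refine continuousOn_finsetSum _ fun i _ => ?_
  exact (h2.continuousOn.clm_apply continuousOn_const).clm_apply continuousOn_const

/-- Green's identity in Euclidean space, weighted by the radial cutoff: since the gradient of the
cutoff is radial, it is orthogonal to the gradients of radially constant functions. -/
lemma integral_cutoff_mul_laplacian_sub [MeasurableSpace E] [BorelSpace E]
    (μ : Measure E) [μ.IsAddHaarMeasure] {F H : E → ℝ}
    (hF : ContDiffOn ℝ 2 F {0}ᶜ) (hH : ContDiffOn ℝ 2 H {0}ᶜ)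
    (hF0 : IsRadiallyConstant F) (hH0 : IsRadiallyConstant H) :
    ∫ y, cutoff y * (H y * Laplacian.laplacian F y - F y * Laplacian.laplacian H y) ∂μ = 0 := by
  set b := stdOrthonormalBasis ℝ E
  set g : Fin (Module.finrank ℝ E) → E → ℝ :=
    fun i y => H y * fderiv ℝ F y (b i) - F y * fderiv ℝ H y (b i) with hg
  have hF1 : ContDiffOn ℝ 1 F {0}ᶜ := hF.of_le (by norm_num)
  have hH1 : ContDiffOn ℝ 1 H {0}ᶜ := hH.of_le (by norm_num)
  have hg1 : ∀ i, ContDiffOn ℝ 1 (g i) {0}ᶜ := fun i =>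
    (hH1.mul (contDiffOn_fderiv_apply hF _)).sub (hF1.mul (contDiffOn_fderiv_apply hH _))
  have hgd : ∀ i, ContinuousOn (fun y => fderiv ℝ (g i) y (b i)) {0}ᶜ := fun i =>
    ((hg1 i).continuousOn_fderiv_of_isOpen isOpen_compl_singleton le_rfl).clm_apply
      continuousOn_const
  have hnhds : ∀ {y : E}, y ∈ ({0}ᶜ : Set E) → ({0}ᶜ : Set E) ∈ 𝓝 y := fun hy =>
    isOpen_compl_singleton.mem_nhds hy
  have dF : ∀ {y : E}, y ∈ ({0}ᶜ : Set E) → DifferentiableAt ℝ F y := fun hy =>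
    (hF1.contDiffAt (hnhds hy)).differentiableAt one_ne_zero
  have dH : ∀ {y : E}, y ∈ ({0}ᶜ : Set E) → DifferentiableAt ℝ H y := fun hy =>
    (hH1.contDiffAt (hnhds hy)).differentiableAt one_ne_zero
  have hdiv : ∀ y ∈ ({0}ᶜ : Set E), ∑ i, fderiv ℝ (g i) y (b i)
      = H y * Laplacian.laplacian F y - F y * Laplacian.laplacian H y := by
    intro y hy
    have hd : ∀ {F : E → ℝ}, ContDiffOn ℝ 2 F {0}ᶜ →
        HasFDerivAt (fderiv ℝ F) (fderiv ℝ (fderiv ℝ F) y) y := fun hF =>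
      (((hF.fderiv_of_isOpen isOpen_compl_singleton (m := 1) (by norm_num)).contDiffAt
        (hnhds hy)).differentiableAt one_ne_zero).hasFDerivAt
    have hda : ∀ {F : E → ℝ}, ContDiffOn ℝ 2 F {0}ᶜ → ∀ e : E,
        HasFDerivAt (fun y => fderiv ℝ F y e) ((fderiv ℝ (fderiv ℝ F) y).flip e) y :=
      fun hF e => by simpa using (hd hF).clm_apply (hasFDerivAt_const e y)
    rw [laplacian_eq_sum_fderiv_fderiv b, laplacian_eq_sum_fderiv_fderiv b, Finset.mul_sum,
      Finset.mul_sum, ← Finset.sum_sub_distrib]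
    refine Finset.sum_congr rfl fun i _ => ?_
    have h := ((dH hy).hasFDerivAt.mul (hda hF (b i))).sub
      ((dF hy).hasFDerivAt.mul (hda hH (b i)))
    have h' : fderiv ℝ (g i) y = _ := h.fderiv
    rw [h']
    simp only [FunLike.coe_sub, FunLike.coe_add, FunLike.coe_smul, Pi.sub_apply, Pi.add_apply,
      Pi.smul_apply, ContinuousLinearMap.flip_apply, smul_eq_mul]
    ring
  have hint2 : ∀ i, Integrable (fun y => fderiv ℝ cutoff y (b i) * g i y) μ := by
    intro i
    have hs : tsupport (fun y : E => fderiv ℝ cutoff y (b i)) ⊆ tsupport (cutoff : E → ℝ) := by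
      refine closure_minimal ?_ (isClosed_tsupport _)
      intro y hy
      refine support_fderiv_subset ℝ (f := (cutoff : E → ℝ)) ?_
      intro h0
      exact hy (by simp [h0])
    have hc : HasCompactSupport (fun y : E => fderiv ℝ cutoff y (b i)) :=
      hasCompactSupport_cutoff.of_isClosed_subset (isClosed_tsupport _) hs
    refine Continuous.integrable_of_hasCompactSupport ?_ ?_
    · refine continuous_of_tsupport fun y hy => ?_
      have hy0 := tsupport_cutoff_subset_compl (hs (tsupport_mul_subset_left hy))
      exact (((contDiff_cutoff.continuous_fderiv one_ne_zero).clm_apply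
        continuous_const).continuousAt).mul ((hg1 i).continuousOn.continuousAt (hnhds hy0))
    · exact hc.mul_right
  have hparts : ∀ i, ∫ y, cutoff y * fderiv ℝ (g i) y (b i) ∂μ
      = - ∫ y, fderiv ℝ cutoff y (b i) * g i y ∂μ := by
    intro i
    exact integral_mul_fderiv_eq_neg_fderiv_mul_of_integrable (hint2 i)
      (cutoff_mul_integrable μ (hgd i)) (cutoff_mul_integrable μ (hg1 i).continuousOn)
      (fun y _ => (contDiff_cutoff.differentiable one_ne_zero) y)
      (fun y hy => ((hg1 i).contDiffAt (hnhds (tsupport_cutoff_subset_compl hy))).differentiableAt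
        one_ne_zero)
  -- The gradient of the cutoff is a multiple of `y`, so Euler's identity applies.
  have hzero : ∀ y : E, ∑ i, fderiv ℝ cutoff y (b i) * g i y = 0 := by
    intro y
    by_cases hy : y = 0
    · simp [fderiv_cutoff, hy]
    have hy' : y ∈ ({0}ᶜ : Set E) := hy
    have hexp : ∀ L : E →L[ℝ] ℝ, ∑ i, ⟪y, b i⟫_ℝ * L (b i) = L y := by
      intro L
      conv_rhs => rw [← b.sum_repr' y]
      rw [map_sum]
      refine Finset.sum_congr rfl fun i _ => ?_
      rw [map_smul, smul_eq_mul, real_inner_comm]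
    have h1 := hexp (fderiv ℝ F y)
    have h2 := hexp (fderiv ℝ H y)
    rw [hF0.fderiv_self (dF hy')] at h1
    rw [hH0.fderiv_self (dH hy')] at h2
    calc ∑ i, fderiv ℝ cutoff y (b i) * g i y
        = 2 * deriv profile (‖y‖ ^ 2) * (H y * ∑ i, ⟪y, b i⟫_ℝ * fderiv ℝ F y (b i)
          - F y * ∑ i, ⟪y, b i⟫_ℝ * fderiv ℝ H y (b i)) := by
          simp only [Finset.mul_sum, ← Finset.sum_sub_distrib]
          refine Finset.sum_congr rfl fun i _ => ?_
          rw [fderiv_cutoff, hg]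
          ring
      _ = 0 := by rw [h1, h2]; ring
  calc ∫ y, cutoff y * (H y * Laplacian.laplacian F y - F y * Laplacian.laplacian H y) ∂μ
      = ∫ y, ∑ i, cutoff y * fderiv ℝ (g i) y (b i) ∂μ := by
        refine integral_congr_ae (Eventually.of_forall fun y => ?_)
        simp only
        by_cases hy : y = 0
        · have : cutoff y = 0 := by
            refine image_eq_zero_of_notMem_tsupport fun h => ?_
            exact tsupport_cutoff_subset_compl h hy
          simp [this]
        · rw [← Finset.mul_sum, hdiv y hy]
    _ = ∑ i, -∫ y, fderiv ℝ cutoff y (b i) * g i y ∂μ := by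
        rw [integral_finsetSum _ fun i _ => cutoff_mul_integrable μ (hgd i)]
        exact Finset.sum_congr rfl fun i _ => hparts i
    _ = -∫ y, ∑ i, fderiv ℝ cutoff y (b i) * g i y ∂μ := by
        rw [integral_finsetSum _ fun i _ => hint2 i, Finset.sum_neg_distrib]
    _ = 0 := by simp only [hzero, integral_zero, neg_zero]

end Green

section SphereGreen

variable {d : ℕ}

lemma radialExt_coe (f : Sphere d → ℝ) (w : Sphere d) :
    radialExt f (w : EuclideanSpace ℝ (Fin (d + 1))) = f w := by
  have hw : ‖(w : EuclideanSpace ℝ (Fin (d + 1)))‖ = 1 := norm_eq_of_mem_sphere w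
  have h0 : (w : EuclideanSpace ℝ (Fin (d + 1))) ≠ 0 := by
    intro h; rw [h, norm_zero] at hw; exact zero_ne_one hw
  rw [radialExt, dif_neg h0]
  congr 1
  exact Subtype.ext (by simp [hw])

lemma isRadiallyConstant_radialExt (f : Sphere d → ℝ) : IsRadiallyConstant (radialExt f) := by
  intro r hr y
  by_cases hy : y = 0
  · simp [hy]
  have h0 : r • y ≠ 0 := smul_ne_zero hr.ne' hy
  rw [radialExt, radialExt, dif_neg h0, dif_neg hy]
  congr 1
  refine Subtype.ext ?_
  simp only
  rw [norm_smul, Real.norm_eq_abs, abs_of_pos hr, smul_smul, mul_inv]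
  congr 1
  field_simp

lemma coe_sphere_mem_compl (w : Sphere d) :
    (w : EuclideanSpace ℝ (Fin (d + 1))) ∈ ({0}ᶜ : Set (EuclideanSpace ℝ (Fin (d + 1)))) :=
  ne_zero_of_mem_unit_sphere w

lemma IsC2.continuous {f : Sphere d → ℝ} (hf : IsC2 f) : Continuous f := by
  have h : Continuous fun w : Sphere d => radialExt f w :=
    hf.continuousOn.comp_continuous continuous_subtype_val coe_sphere_mem_compl
  simpa only [radialExt_coe] using h

lemma IsC2.continuous_sphereLaplacian {f : Sphere d → ℝ} (hf : IsC2 f) :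
    Continuous (sphereLaplacian f) :=
  (continuousOn_laplacian hf).comp_continuous continuous_subtype_val coe_sphere_mem_compl

instance : IsFiniteMeasure (surface d) := by unfold surface; infer_instance

instance : (surface d).IsOpenPosMeasure := by unfold surface; infer_instance

lemma integrable_surface {f : Sphere d → ℝ} (hf : Continuous f) : Integrable f (surface d) :=
  hf.integrable_of_hasCompactSupport (HasCompactSupport.of_compactSpace f)

/-- The Laplace-Beltrami operator of the sphere is symmetric. -/
theorem integral_mul_sphereLaplacian_comm {f h : Sphere d → ℝ} (hf : IsC2 f) (hh : IsC2 h) :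
    ∫ w, h w * sphereLaplacian f w ∂(surface d) = ∫ w, f w * sphereLaplacian h w ∂(surface d) := by
  obtain ⟨c, hc0, hc⟩ := exists_integral_cutoff_mul
    (volume : Measure (EuclideanSpace ℝ (Fin (d + 1))))
  have h1 := hc (fun y => radialExt h y * Laplacian.laplacian (radialExt f) y
    - radialExt f y * Laplacian.laplacian (radialExt h) y) (fun r hr y _ => by
      rw [(isRadiallyConstant_radialExt f).laplacian_smul hr,
        (isRadiallyConstant_radialExt h).laplacian_smul hr,
        isRadiallyConstant_radialExt f r hr, isRadiallyConstant_radialExt h r hr]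
      ring)
  rw [integral_cutoff_mul_laplacian_sub _ hf hh (isRadiallyConstant_radialExt f)
    (isRadiallyConstant_radialExt h)] at h1
  have h2 := (mul_eq_zero.1 h1.symm).resolve_left hc0
  simp only [radialExt_coe] at h2
  have h3 : ∫ w, (h w * sphereLaplacian f w - f w * sphereLaplacian h w) ∂(surface d) = 0 := h2
  have h4 := integral_sub (integrable_surface (hh.continuous.mul hf.continuous_sphereLaplacian))
    (integrable_surface (hf.continuous.mul hh.continuous_sphereLaplacian))
  exact sub_eq_zero.1 (h4.symm.trans h3)

end SphereGreen

/-! ### Zonal functions -/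

section Zonal

variable {E : Type*} [NormedAddCommGroup E] [InnerProductSpace ℝ E]

lemma hasFDerivAt_norm_inv {y : E} (hy : y ≠ 0) :
    HasFDerivAt (fun y : E => ‖y‖⁻¹) (-(‖y‖ ^ 3)⁻¹ • innerSL ℝ y) y := by
  have hn : ‖y‖ ≠ 0 := norm_ne_zero_iff.2 hy
  have h1 : HasFDerivAt (fun y : E => ‖y‖ ^ 2) (2 • innerSL ℝ y) y :=
    (hasStrictFDerivAt_norm_sq y).hasFDerivAt
  have h2 := h1.sqrt (pow_ne_zero 2 hn)
  simp only [Real.sqrt_sq (norm_nonneg _)] at h2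
  have h3 := (hasDerivAt_inv hn).comp_hasFDerivAt y h2
  refine h3.congr_fderiv ?_
  ext e
  simp
  field_simp

lemma hasFDerivAt_inner_mul_norm_inv (z : E) {y : E} (hy : y ≠ 0) :
    HasFDerivAt (fun y : E => ⟪z, y⟫_ℝ * ‖y‖⁻¹)
      (‖y‖⁻¹ • innerSL ℝ z - (⟪z, y⟫_ℝ * ‖y‖⁻¹ ^ 3) • innerSL ℝ y) y := by
  have h := ((innerSL ℝ z).hasFDerivAt (x := y)).mul (hasFDerivAt_norm_inv hy)
  refine h.congr_fderiv ?_
  ext e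
  simp
  ring

/-- The Laplacian, on the unit sphere, of a function of the cosine of the angle to a fixed unit
vector. -/
lemma laplacian_eval_inner_mul_norm_inv [FiniteDimensional ℝ E] (P : Polynomial ℝ) {z y : E}
    (hz : ‖z‖ = 1) (hy1 : ‖y‖ = 1) :
    Laplacian.laplacian (fun y : E => P.eval (⟪z, y⟫_ℝ * ‖y‖⁻¹)) y
      = (1 - ⟪z, y⟫_ℝ ^ 2) * P.derivative.derivative.eval ⟪z, y⟫_ℝ
        - ((Module.finrank ℝ E : ℝ) - 1) * ⟪z, y⟫_ℝ * P.derivative.eval ⟪z, y⟫_ℝ := by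
  have hy : y ≠ 0 := by rintro rfl; simp at hy1
  set b := stdOrthonormalBasis ℝ E
  have hPc : ∀ (P : Polynomial ℝ) {y : E}, y ≠ 0 →
      HasFDerivAt (fun y : E => P.eval (⟪z, y⟫_ℝ * ‖y‖⁻¹))
        (P.derivative.eval (⟪z, y⟫_ℝ * ‖y‖⁻¹) •
          (‖y‖⁻¹ • innerSL ℝ z - (⟪z, y⟫_ℝ * ‖y‖⁻¹ ^ 3) • innerSL ℝ y)) y := fun P y hy =>
    (P.hasDerivAt _).comp_hasFDerivAt y (hasFDerivAt_inner_mul_norm_inv z hy)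
  have hfd : fderiv ℝ (fun y : E => P.eval (⟪z, y⟫_ℝ * ‖y‖⁻¹)) =ᶠ[𝓝 y] fun y =>
      P.derivative.eval (⟪z, y⟫_ℝ * ‖y‖⁻¹) •
          (‖y‖⁻¹ • innerSL ℝ z - (⟪z, y⟫_ℝ * ‖y‖⁻¹ ^ 3) • innerSL ℝ y) := by
    filter_upwards [isOpen_compl_singleton.mem_nhds (show y ∈ ({0}ᶜ : Set E) from hy)] with x hx
      using (hPc P hx).fderiv
  have hsecond : ∀ e : E, fderiv ℝ (fderiv ℝ fun y : E => P.eval (⟪z, y⟫_ℝ * ‖y‖⁻¹)) y e e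
      = P.derivative.derivative.eval ⟪z, y⟫_ℝ * (⟪z, e⟫_ℝ - ⟪z, y⟫_ℝ * ⟪y, e⟫_ℝ) ^ 2
        + P.derivative.eval ⟪z, y⟫_ℝ * (-2 * (⟪z, e⟫_ℝ * ⟪y, e⟫_ℝ)
          + 3 * ⟪z, y⟫_ℝ * ⟪y, e⟫_ℝ ^ 2 - ⟪z, y⟫_ℝ * ‖e‖ ^ 2) := by
    intro e
    have hn := hasFDerivAt_norm_inv hy
    obtain ⟨L, hL⟩ : ∃ L : E →L[ℝ] E →L[ℝ] ℝ, ∀ v, L v = innerSL ℝ v :=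
      ⟨innerSL ℝ, fun _ => rfl⟩
    have hL' : HasFDerivAt (fun y : E => innerSL ℝ y) L y :=
      (L.hasFDerivAt (x := y)).congr_of_eventuallyEq (Eventually.of_forall fun v => (hL v).symm)
    have hv : HasFDerivAt (fun y : E => ‖y‖⁻¹ • innerSL ℝ z
        - (⟪z, y⟫_ℝ * ‖y‖⁻¹ ^ 3) • innerSL ℝ y) _ y :=
      (hn.smul_const (innerSL ℝ z)).sub
        ((((innerSL ℝ z).hasFDerivAt (x := y)).mul (hn.pow 3)).smul
          hL')
    have h := (hPc P.derivative hy).smul hv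
    have h' := hfd.fderiv_eq.trans h.fderiv
    rw [h']
    simp [hy1, hL]
    ring
  rw [laplacian_eq_sum_fderiv_fderiv b]
  simp only [hsecond, b.norm_eq_one]
  have hs : ∀ v w : E, ∑ i, ⟪v, b i⟫_ℝ * ⟪w, b i⟫_ℝ = ⟪v, w⟫_ℝ := by
    intro v w
    rw [← b.sum_inner_mul_inner v w]
    exact Finset.sum_congr rfl fun i _ => by rw [real_inner_comm w]
  have hzz := hs z z
  have hzy := hs z y
  have hyy := hs y y
  rw [real_inner_self_eq_norm_sq, hz] at hzz
  rw [real_inner_self_eq_norm_sq, hy1] at hyy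
  have hcard : ∑ _i : Fin (Module.finrank ℝ E), (1 : ℝ) = Module.finrank ℝ E := by simp
  set s := ⟪z, y⟫_ℝ
  set p1 := P.derivative.eval s
  set p2 := P.derivative.derivative.eval s
  calc _ = p2 * (∑ i, ⟪z, b i⟫_ℝ * ⟪z, b i⟫_ℝ - 2 * s * ∑ i, ⟪z, b i⟫_ℝ * ⟪y, b i⟫_ℝ
          + s ^ 2 * ∑ i, ⟪y, b i⟫_ℝ * ⟪y, b i⟫_ℝ)
        + p1 * (-2 * ∑ i, ⟪z, b i⟫_ℝ * ⟪y, b i⟫_ℝ + 3 * s * ∑ i, ⟪y, b i⟫_ℝ * ⟪y, b i⟫_ℝ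
          - s * ∑ _i : Fin (Module.finrank ℝ E), (1 : ℝ)) := by
        simp only [Finset.mul_sum, ← Finset.sum_sub_distrib, ← Finset.sum_add_distrib]
        exact Finset.sum_congr rfl fun i _ => by ring
    _ = _ := by rw [hzz, hzy, hyy, hcard]; ring

end Zonal

section ZonalSphere

variable {d : ℕ}

/-- The function `y ↦ P (⟨z, y⟩)` on the sphere, invariant under rotations fixing the pole `z`. -/
noncomputable def zonal (P : Polynomial ℝ) (z y : Sphere d) : ℝ :=
  P.eval ⟪(z : EuclideanSpace ℝ (Fin (d + 1))), (y : EuclideanSpace ℝ (Fin (d + 1)))⟫_ℝ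

lemma zonal_comm (P : Polynomial ℝ) (z y : Sphere d) : zonal P z y = zonal P y z := by
  rw [zonal, zonal, real_inner_comm]

lemma radialExt_zonal (P : Polynomial ℝ) (z : Sphere d) {y : EuclideanSpace ℝ (Fin (d + 1))}
    (hy : y ≠ 0) : radialExt (zonal P z) y =
      P.eval (⟪(z : EuclideanSpace ℝ (Fin (d + 1))), y⟫_ℝ * ‖y‖⁻¹) := by
  rw [radialExt, dif_neg hy, zonal, real_inner_smul_right, mul_comm]

lemma isC2_zonal (P : Polynomial ℝ) (z : Sphere d) : IsC2 (zonal P z) := by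
  have h : ContDiffOn ℝ 2 (fun y : EuclideanSpace ℝ (Fin (d + 1)) =>
      P.eval (⟪(z : EuclideanSpace ℝ (Fin (d + 1))), y⟫_ℝ * ‖y‖⁻¹)) {0}ᶜ := by
    have hu : ContDiffOn ℝ 2 (fun y : EuclideanSpace ℝ (Fin (d + 1)) =>
        ⟪(z : EuclideanSpace ℝ (Fin (d + 1))), y⟫_ℝ * ‖y‖⁻¹) {0}ᶜ := by
      refine ContDiffOn.mul (contDiffOn_const.inner ℝ contDiffOn_id) ?_
      exact (contDiffOn_id.norm ℝ fun y hy => hy).inv fun y hy => norm_ne_zero_iff.2 hy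
    exact (P.contDiff_aeval 2).comp_contDiffOn hu
  exact h.congr fun y hy => radialExt_zonal P z hy

lemma continuous_zonal (P : Polynomial ℝ) (z : Sphere d) : Continuous (zonal P z) :=
  (isC2_zonal P z).continuous

lemma sphereLaplacian_zonal (P : Polynomial ℝ) (z y : Sphere d) :
    sphereLaplacian (zonal P z) y = zonal ((1 - Polynomial.X ^ 2) * P.derivative.derivative
      - Polynomial.C (d : ℝ) * Polynomial.X * P.derivative) z y := by
  have hev : radialExt (zonal P z) =ᶠ[𝓝 (y : EuclideanSpace ℝ (Fin (d + 1)))]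
      fun y => P.eval (⟪(z : EuclideanSpace ℝ (Fin (d + 1))), y⟫_ℝ * ‖y‖⁻¹) := by
    filter_upwards [isOpen_compl_singleton.mem_nhds (coe_sphere_mem_compl y)] with x hx
      using radialExt_zonal P z hx
  rw [sphereLaplacian, (InnerProductSpace.laplacian_congr_nhds hev).eq_of_nhds,
    laplacian_eval_inner_mul_norm_inv P (norm_eq_of_mem_sphere z) (norm_eq_of_mem_sphere y), zonal]
  simp

end ZonalSphere

/-! ### Gegenbauer polynomials -/

open Polynomial in
lemma gegenbauer_zero (α : ℝ) : gegenbauer α 0 = 1 := by rw [gegenbauer]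

open Polynomial in
lemma gegenbauer_one (α : ℝ) : gegenbauer α 1 = C (2 * α) * X := by rw [gegenbauer]

open Polynomial in
lemma gegenbauer_add_two (α : ℝ) (n : ℕ) :
    C ((n : ℝ) + 2) * gegenbauer α (n + 2) = C (2 * ((n : ℝ) + 1 + α)) * X * gegenbauer α (n + 1)
      - C ((n : ℝ) + 2 * α) * gegenbauer α n := by
  have h : (n : ℝ) + 2 ≠ 0 := by positivity
  rw [gegenbauer, ← mul_assoc, ← C_mul, mul_one_div_cancel h, C_1, one_mul]

open Polynomial in
/-- Two first-order relations between consecutive Gegenbauer polynomials, proved together. -/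
lemma gegenbauer_derivative_aux (α : ℝ) (n : ℕ) :
    derivative (gegenbauer α (n + 1)) = C ((n : ℝ) + 2 * α) * gegenbauer α n
        + X * derivative (gegenbauer α n) ∧
    (1 - X ^ 2) * derivative (gegenbauer α n) = C ((n : ℝ) + 2 * α) * X * gegenbauer α n
        - C ((n : ℝ) + 1) * gegenbauer α (n + 1) := by
  induction n with
  | zero => simp [gegenbauer_zero, gegenbauer_one]
  | succ n ih =>
    obtain ⟨h1, h2⟩ := ih
    have hr := gegenbauer_add_two α n
    have hd := congrArg derivative hr
    have hn : C ((n : ℝ) + 2) ≠ 0 := by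
      rw [Ne, C_eq_zero]; positivity
    simp only [derivative_mul, derivative_sub, derivative_C, derivative_X, zero_mul,
      zero_add, mul_one] at hd
    have h3 : (1 - X ^ 2) * derivative (gegenbauer α (n + 1))
        = C (((n + 1 : ℕ) : ℝ) + 2 * α) * X * gegenbauer α (n + 1)
        - C (((n + 1 : ℕ) : ℝ) + 1) * gegenbauer α (n + 1 + 1) := by
      push_cast
      simp only [map_add, map_mul, map_one, map_ofNat, map_natCast] at *
      linear_combination (1 - X ^ 2) * h1 + X * h2 + hr
    refine ⟨?_, h3⟩
    refine mul_left_cancel₀ hn ?_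
    push_cast
    simp only [map_add, map_mul, map_one, map_ofNat, map_natCast] at *
    linear_combination hd - (n + 2 * C α) * (h2 - X * h1)

open Polynomial in
lemma derivative_gegenbauer_succ (α : ℝ) (n : ℕ) :
    derivative (gegenbauer α (n + 1)) = C ((n : ℝ) + 2 * α) * gegenbauer α n
        + X * derivative (gegenbauer α n) := (gegenbauer_derivative_aux α n).1

open Polynomial in
lemma one_sub_sq_mul_derivative_gegenbauer (α : ℝ) (n : ℕ) :
    (1 - X ^ 2) * derivative (gegenbauer α n) = C ((n : ℝ) + 2 * α) * X * gegenbauer α n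
        - C ((n : ℝ) + 1) * gegenbauer α (n + 1) := (gegenbauer_derivative_aux α n).2

open Polynomial in
/-- The Gegenbauer differential equation. -/
lemma gegenbauer_ode (α : ℝ) (n : ℕ) :
    (1 - X ^ 2) * derivative (derivative (gegenbauer α n))
      - C (2 * α + 1) * X * derivative (gegenbauer α n)
      = - (C ((n : ℝ) * (n + 2 * α)) * gegenbauer α n) := by
  have hd := congrArg derivative (one_sub_sq_mul_derivative_gegenbauer α n)
  have h1 := derivative_gegenbauer_succ α n
  simp only [derivative_mul, derivative_sub, derivative_C, derivative_X, derivative_one,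
    derivative_X_pow, zero_mul, zero_add, mul_one, zero_sub] at hd
  simp only [map_add, map_mul, map_one, map_ofNat, map_natCast] at *
  linear_combination hd - ((n : ℝ[X]) + 1) * h1

/-- The value at `1`, through its two-term recurrence. -/
lemma gegenbauer_eval_one_succ (α : ℝ) (n : ℕ) :
    ((n : ℝ) + 1) * (gegenbauer α (n + 1)).eval 1
      = ((n : ℝ) + 2 * α) * (gegenbauer α n).eval 1 := by
  have h := congrArg (Polynomial.eval 1) (one_sub_sq_mul_derivative_gegenbauer α n)
  simp at h
  linarith

lemma gegenbauer_eval_one_pos {α : ℝ} (hα : 0 < α) (n : ℕ) : 0 < (gegenbauer α n).eval 1 := by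
  induction n with
  | zero => simp [gegenbauer_zero]
  | succ n ih =>
    have h := gegenbauer_eval_one_succ α n
    have : 0 < ((n : ℝ) + 1) * (gegenbauer α (n + 1)).eval 1 := by rw [h]; positivity
    exact pos_of_mul_pos_right this (by positivity)

/-- A crude polynomial bound: by Bernoulli's inequality, `(k + 1) ^ d` grows at least as fast as the
values at `1`. -/
lemma gegenbauer_eval_one_le {d : ℕ} (hd : 2 ≤ d) (n : ℕ) :
    (gegenbauer (((d : ℝ) - 1) / 2) n).eval 1 ≤ ((n : ℝ) + 1) ^ d := by
  have hd' : (2 : ℝ) ≤ d := by exact_mod_cast hd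
  induction n with
  | zero => simp [gegenbauer_zero]
  | succ n ih =>
    have h := gegenbauer_eval_one_succ (((d : ℝ) - 1) / 2) n
    have hn : (0 : ℝ) < (n : ℝ) + 1 := by positivity
    have hb := one_add_mul_le_pow (a := 1 / ((n : ℝ) + 1))
      (le_trans (by norm_num) (by positivity : (0 : ℝ) ≤ 1 / ((n : ℝ) + 1))) d
    have e1 : (1 + 1 / ((n : ℝ) + 1)) = ((n : ℝ) + 2) / (n + 1) := by field_simp; ring
    have e2 : 1 + (d : ℝ) * (1 / ((n : ℝ) + 1)) = ((n : ℝ) + 1 + d) / (n + 1) := by field_simp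
    rw [e1, e2, div_pow, div_le_div_iff₀ hn (by positivity)] at hb
    have hb' : ((n : ℝ) + 1 + d) * ((n : ℝ) + 1) ^ d ≤ ((n : ℝ) + 1) * ((n : ℝ) + 2) ^ d := by
      linarith
    refine le_of_mul_le_mul_left ?_ hn
    rw [h]
    push_cast
    calc ((n : ℝ) + 2 * (((d : ℝ) - 1) / 2)) * (gegenbauer (((d : ℝ) - 1) / 2) n).eval 1
        ≤ ((n : ℝ) + 2 * (((d : ℝ) - 1) / 2)) * ((n : ℝ) + 1) ^ d :=
          mul_le_mul_of_nonneg_left ih (by linarith)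
      _ ≤ ((n : ℝ) + 1 + d) * ((n : ℝ) + 1) ^ d :=
          mul_le_mul_of_nonneg_right (by linarith) (by positivity)
      _ ≤ ((n : ℝ) + 1) * ((n : ℝ) + 2) ^ d := hb'
      _ = _ := by ring

open Polynomial in
/-- The Gegenbauer polynomials span the space of all polynomials. -/
lemma exists_eq_sum_gegenbauer {α : ℝ} (hα : 0 < α) (P : ℝ[X]) :
    ∃ a : ℕ →₀ ℝ, P = a.sum fun j c => C c * gegenbauer α j := by
  suffices h : P ∈ Submodule.span ℝ (range (gegenbauer α)) by
    obtain ⟨a, ha⟩ := (Finsupp.mem_span_range_iff_exists_finsupp).1 h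
    exact ⟨a, by rw [← ha]; simp only [smul_eq_C_mul]⟩
  have hX : ∀ k, X * gegenbauer α k ∈ Submodule.span ℝ (range (gegenbauer α)) := by
    intro k
    have hg : ∀ k, gegenbauer α k ∈ Submodule.span ℝ (range (gegenbauer α)) :=
      fun k => Submodule.subset_span ⟨k, rfl⟩
    cases k with
    | zero =>
      have : X * gegenbauer α 0 = (2 * α)⁻¹ • gegenbauer α 1 := by
        rw [gegenbauer_zero, gegenbauer_one, smul_eq_C_mul, ← mul_assoc, ← C_mul,
          inv_mul_cancel₀ (by positivity)]
        simp
      rw [this]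
      exact Submodule.smul_mem _ _ (hg 1)
    | succ n =>
      have h := gegenbauer_add_two α n
      have : X * gegenbauer α (n + 1) = (2 * ((n : ℝ) + 1 + α))⁻¹ •
          (((n : ℝ) + 2) • gegenbauer α (n + 2) + ((n : ℝ) + 2 * α) • gegenbauer α n) := by
        simp only [smul_eq_C_mul]
        rw [h, sub_add_cancel, mul_assoc, ← mul_assoc (C _) (C _), ← C_mul,
          inv_mul_cancel₀ (by positivity)]
        simp
      rw [this]
      exact Submodule.smul_mem _ _ (Submodule.add_mem _ (Submodule.smul_mem _ _ (hg _))
        (Submodule.smul_mem _ _ (hg _)))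
  have hX' : ∀ Q ∈ Submodule.span ℝ (range (gegenbauer α)),
      X * Q ∈ Submodule.span ℝ (range (gegenbauer α)) := by
    intro Q hQ
    induction hQ using Submodule.span_induction with
    | mem Q hQ => obtain ⟨k, rfl⟩ := hQ; exact hX k
    | zero => simp
    | add P Q _ _ hP hQ => rw [mul_add]; exact Submodule.add_mem _ hP hQ
    | smul c Q _ hQ => rw [mul_smul_comm]; exact Submodule.smul_mem _ _ hQ
  induction P using Polynomial.induction_on with
  | C c =>
    have : C c = c • gegenbauer α 0 := by rw [gegenbauer_zero, smul_eq_C_mul, mul_one]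
    rw [this]
    exact Submodule.smul_mem _ _ (Submodule.subset_span ⟨0, rfl⟩)
  | add P Q hP hQ => exact Submodule.add_mem _ hP hQ
  | monomial n c ih =>
    have : C c * X ^ (n + 1) = X * (C c * X ^ n) := by ring
    rw [this]
    exact hX' _ ih

/-! ### Zonal Gegenbauer functions -/

section Orthogonality

variable {d : ℕ}

/-- The zonal Gegenbauer function `y ↦ C_k^((d-1)/2) (⟨z, y⟩)` on `S^d`. -/
noncomputable def zonalGegenbauer (d k : ℕ) : Sphere d → Sphere d → ℝ :=
  zonal (gegenbauer (((d : ℝ) - 1) / 2) k)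

/-- The eigenvalue `k (k + d - 1)` of `-Δ` on spherical harmonics of degree `k` on `S^d`. -/
noncomputable def eigenvalue (d k : ℕ) : ℝ := (k : ℝ) * ((k : ℝ) + (d : ℝ) - 1)

lemma continuous_zonalGegenbauer (k : ℕ) (z : Sphere d) : Continuous (zonalGegenbauer d k z) :=
  continuous_zonal _ z

lemma zonalGegenbauer_comm (k : ℕ) (z y : Sphere d) :
    zonalGegenbauer d k z y = zonalGegenbauer d k y z := zonal_comm _ z y

lemma zonalGegenbauer_zero (z y : Sphere d) : zonalGegenbauer d 0 z y = 1 := by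
  simp [zonalGegenbauer, zonal, gegenbauer_zero]

lemma zonalGegenbauer_self (k : ℕ) (z : Sphere d) :
    zonalGegenbauer d k z z = (gegenbauer (((d : ℝ) - 1) / 2) k).eval 1 := by
  rw [zonalGegenbauer, zonal, real_inner_self_eq_norm_sq, norm_eq_of_mem_sphere, one_pow]

lemma sphereLaplacian_zonalGegenbauer (k : ℕ) (z y : Sphere d) :
    sphereLaplacian (zonalGegenbauer d k z) y = -(eigenvalue d k * zonalGegenbauer d k z y) := by
  have h := gegenbauer_ode (((d : ℝ) - 1) / 2) k
  rw [show 2 * (((d : ℝ) - 1) / 2) = (d : ℝ) - 1 by ring, sub_add_cancel] at h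
  rw [zonalGegenbauer, sphereLaplacian_zonal, h, zonal, zonal, eigenvalue]
  simp only [Polynomial.eval_neg, Polynomial.eval_mul, Polynomial.eval_C]
  ring

lemma eigenvalue_strictMono (hd : 2 ≤ d) : StrictMono (eigenvalue d) := by
  intro j k hjk
  have h1 : (j : ℝ) < k := by exact_mod_cast hjk
  have h2 : (2 : ℝ) ≤ d := by exact_mod_cast hd
  have h3 : (0 : ℝ) ≤ j := by positivity
  unfold eigenvalue
  nlinarith

lemma integral_zonalGegenbauer_mul_of_ne (hd : 2 ≤ d) {j k : ℕ} (hjk : j ≠ k) (x z : Sphere d) :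
    ∫ y, zonalGegenbauer d j x y * zonalGegenbauer d k z y ∂(surface d) = 0 := by
  have h := integral_mul_sphereLaplacian_comm
    (isC2_zonal (gegenbauer (((d : ℝ) - 1) / 2) k) z)
    (isC2_zonal (gegenbauer (((d : ℝ) - 1) / 2) j) x)
  have hk := sphereLaplacian_zonalGegenbauer k z
  have hj := sphereLaplacian_zonalGegenbauer j x
  unfold zonalGegenbauer at hk hj ⊢
  simp only [hk, hj] at h
  set I := ∫ y, zonal (gegenbauer (((d : ℝ) - 1) / 2) j) x y *
    zonal (gegenbauer (((d : ℝ) - 1) / 2) k) z y ∂(surface d) with hI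
  have e1 : ∫ w, zonal (gegenbauer (((d : ℝ) - 1) / 2) j) x w *
      -(eigenvalue d k * zonal (gegenbauer (((d : ℝ) - 1) / 2) k) z w) ∂(surface d)
      = -eigenvalue d k * I := by
    rw [hI, ← integral_const_mul]
    congr 1; ext w; ring
  have e2 : ∫ w, zonal (gegenbauer (((d : ℝ) - 1) / 2) k) z w *
      -(eigenvalue d j * zonal (gegenbauer (((d : ℝ) - 1) / 2) j) x w) ∂(surface d)
      = -eigenvalue d j * I := by
    rw [hI, ← integral_const_mul]
    congr 1; ext w; ring
  rw [e1, e2] at h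
  have hne : eigenvalue d j - eigenvalue d k ≠ 0 :=
    sub_ne_zero.2 ((eigenvalue_strictMono hd).injective.ne hjk)
  refine (mul_eq_zero.1 ?_).resolve_left hne
  linarith

lemma zonalGegenbauer_add_two (n : ℕ) (z y : Sphere d) :
    ((n : ℝ) + 2) * zonalGegenbauer d (n + 2) z y
      = (2 * n + d + 1) * (zonal Polynomial.X z y * zonalGegenbauer d (n + 1) z y)
        - (n + d - 1) * zonalGegenbauer d n z y := by
  have h := congrArg (Polynomial.eval ⟪(z : EuclideanSpace ℝ (Fin (d + 1))),
    (y : EuclideanSpace ℝ (Fin (d + 1)))⟫_ℝ) (gegenbauer_add_two (((d : ℝ) - 1) / 2) n)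
  simp only [Polynomial.eval_mul, Polynomial.eval_sub, Polynomial.eval_C, Polynomial.eval_X] at h
  simp only [zonalGegenbauer, zonal, Polynomial.eval_X]
  linear_combination h

/-- The three-term recurrence integrated against `C_n`, where orthogonality kills the term of degree
`n + 2`. -/
lemma integral_X_mul_zonalGegenbauer (hd : 2 ≤ d) (n : ℕ) (z : Sphere d) :
    (2 * (n : ℝ) + d + 1) * ∫ y, zonal Polynomial.X z y * zonalGegenbauer d (n + 1) z y
        * zonalGegenbauer d n z y ∂(surface d)
      = (n + d - 1) * ∫ y, zonalGegenbauer d n z y ^ 2 ∂(surface d) := by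
  have h0 := integral_zonalGegenbauer_mul_of_ne hd (show n + 2 ≠ n by omega) z z
  have c := fun k => continuous_zonalGegenbauer k z
  have cX := continuous_zonal Polynomial.X z
  have e : ∫ y, ((n : ℝ) + 2) * (zonalGegenbauer d (n + 2) z y * zonalGegenbauer d n z y)
        ∂(surface d)
      = ∫ y, (2 * n + d + 1) * (zonal Polynomial.X z y * zonalGegenbauer d (n + 1) z y
          * zonalGegenbauer d n z y) ∂(surface d)
        - ∫ y, (n + d - 1) * zonalGegenbauer d n z y ^ 2 ∂(surface d) := by
    refine Eq.trans ?_ (integral_sub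
      (integrable_surface (continuous_const.mul ((cX.mul (c _)).mul (c _))))
      (integrable_surface (continuous_const.mul ((c _).pow 2))))
    congr 1; ext y
    linear_combination zonalGegenbauer d n z y * zonalGegenbauer_add_two n z y
  rw [integral_const_mul, integral_const_mul, integral_const_mul, h0] at e
  linear_combination -e

/-- The squared norm of a zonal Gegenbauer function, computed from the three-term recurrence and
orthogonality. -/
lemma integral_zonalGegenbauer_sq (hd : 2 ≤ d) (k : ℕ) (z : Sphere d) :
    (2 * (k : ℝ) + d - 1) * ∫ y, zonalGegenbauer d k z y ^ 2 ∂(surface d)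
      = area d * (d - 1) * zonalGegenbauer d k z z := by
  have c := fun k => continuous_zonalGegenbauer k z
  have cX := continuous_zonal Polynomial.X z
  have hval : ∀ n : ℕ, ((n : ℝ) + 1) * zonalGegenbauer d (n + 1) z z
      = (n + d - 1) * zonalGegenbauer d n z z := by
    intro n
    rw [zonalGegenbauer_self, zonalGegenbauer_self, gegenbauer_eval_one_succ]
    ring
  have hone : ∀ y, zonalGegenbauer d 1 z y = (d - 1) * zonal Polynomial.X z y := by
    intro y
    simp only [zonalGegenbauer, zonal, gegenbauer_one, Polynomial.eval_mul, Polynomial.eval_C,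
      Polynomial.eval_X]
    ring
  have h00 : ∫ y, zonalGegenbauer d 0 z y ^ 2 ∂(surface d) = area d := by
    simp [zonalGegenbauer_zero, area]
  induction k with
  | zero => rw [h00, zonalGegenbauer_zero]; push_cast; ring
  | succ n ih =>
    -- The recurrence one degree lower, integrated against `C_{n+1}`.
    have hstep : ((n : ℝ) + 1) * ∫ y, zonalGegenbauer d (n + 1) z y ^ 2 ∂(surface d)
        = (2 * n + d - 1) * ∫ y, zonal Polynomial.X z y * zonalGegenbauer d (n + 1) z y
          * zonalGegenbauer d n z y ∂(surface d) := by
      rcases n with _ | n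
      · rw [← integral_const_mul, ← integral_const_mul]
        congr 1; ext y
        rw [zonalGegenbauer_zero]
        push_cast
        linear_combination zonalGegenbauer d 1 z y * hone y
      · have h0 := integral_zonalGegenbauer_mul_of_ne hd (show n ≠ n + 2 by omega) z z
        have e : ∫ y, ((n : ℝ) + 2) * zonalGegenbauer d (n + 2) z y ^ 2 ∂(surface d)
            = ∫ y, (2 * n + d + 1) * (zonal Polynomial.X z y * zonalGegenbauer d (n + 2) z y
                * zonalGegenbauer d (n + 1) z y) ∂(surface d)
              - ∫ y, (n + d - 1) * (zonalGegenbauer d n z y * zonalGegenbauer d (n + 2) z y)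
                ∂(surface d) := by
          refine Eq.trans ?_ (integral_sub
            (integrable_surface (continuous_const.mul ((cX.mul (c _)).mul (c _))))
            (integrable_surface (continuous_const.mul ((c _).mul (c _)))))
          congr 1; ext y
          linear_combination zonalGegenbauer d (n + 2) z y * zonalGegenbauer_add_two n z y
        rw [integral_const_mul, integral_const_mul, integral_const_mul, h0] at e
        push_cast
        linear_combination e
    have hX := integral_X_mul_zonalGegenbauer hd n z
    have hv := hval n
    have hn : (n : ℝ) + 1 ≠ 0 := by positivity
    refine mul_left_cancel₀ hn ?_
    push_cast
    linear_combination (2 * (n : ℝ) + d + 1) * hstep + (2 * n + d - 1) * hX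
      + (n + d - 1) * ih - area d * (d - 1) * hv

lemma area_pos (d : ℕ) : 0 < area d := by
  have : Nonempty (Sphere d) := (NormedSpace.sphere_nonempty.2 zero_le_one).to_subtype
  exact measureReal_univ_pos

end Orthogonality

section Moments

variable {d : ℕ}

/-- Green's identity turns the heat equation into an ordinary differential equation for the
Gegenbauer moments of a fundamental solution. -/
lemma IsFundamentalSolution.integral_mul_zonalGegenbauer {q : ℝ → Sphere d → Sphere d → ℝ}
    (hq : IsFundamentalSolution d q) (k : ℕ) (x z : Sphere d) {t : ℝ} (ht : 0 < t) :
    ∫ y, q t x y * zonalGegenbauer d k z y ∂(surface d)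
      = Real.exp (-(eigenvalue d k * t) / 2) * zonalGegenbauer d k z x := by
  set h := zonalGegenbauer d k z with hh
  have hc : Continuous h := continuous_zonalGegenbauer k z
  set m : ℝ → ℝ := fun t => ∫ y, q t x y * h y ∂(surface d) with hm
  have hqc : ∀ s, 0 < s → Continuous (fun y => q s x y) := fun s hs => (hq.smooth s hs x).continuous
  have hderiv : ∀ s, 0 < s → HasDerivAt m (-(eigenvalue d k / 2) * m s) s := by
    intro s hs
    have hK : IsCompact (Icc (s / 2) (2 * s) ×ˢ (univ : Set (Sphere d))) :=
      isCompact_Icc.prod isCompact_univ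
    have hcont : ContinuousOn (fun p : ℝ × Sphere d =>
        (1 / 2) * sphereLaplacian (fun y => q p.1 x y) p.2 * h p.2)
        (Icc (s / 2) (2 * s) ×ˢ (univ : Set (Sphere d))) := by
      refine (continuousOn_const.mul ((hq.cont_laplacian x).mono ?_)).mul
        (hc.comp continuous_snd).continuousOn
      exact prod_mono (fun r hr => lt_of_lt_of_le (by positivity) hr.1) subset_rfl
    -- The time derivative is bounded near `s`, uniformly in `y`, by compactness of the sphere.
    obtain ⟨B, hB⟩ := hK.exists_bound_of_continuousOn hcont
    have hlap : Continuous (sphereLaplacian fun y => q s x y) :=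
      (hq.smooth s hs x).continuous_sphereLaplacian
    have hpos : ∀ᶠ r in 𝓝 s, 0 < r := lt_mem_nhds hs
    have hmain := hasDerivAt_integral_of_dominated_loc_of_deriv_le (μ := surface d)
      (F := fun r y => q r x y * h y)
      (F' := fun r y => (1 / 2) * sphereLaplacian (fun y => q r x y) y * h y)
      (bound := fun _ => B) (s := Icc (s / 2) (2 * s)) (x₀ := s)
      (Icc_mem_nhds (by linarith) (by linarith))
      (hpos.mono fun r hr => ((hqc r hr).mul hc).aestronglyMeasurable)
      (integrable_surface ((hqc s hs).mul hc))
      ((continuous_const.mul hlap).mul hc).aestronglyMeasurable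
      (Eventually.of_forall fun y r hr => hB (r, y) ⟨hr, mem_univ _⟩)
      (integrable_const _)
      (Eventually.of_forall fun y r hr =>
        (hq.heat_eq r (lt_of_lt_of_le (by positivity) hr.1) x y).mul_const (h y))
    refine hmain.2.congr_deriv ?_
    have hg := integral_mul_sphereLaplacian_comm (hq.smooth s hs x)
      (isC2_zonal (gegenbauer (((d : ℝ) - 1) / 2) k) z)
    calc ∫ y, (1 / 2) * sphereLaplacian (fun y => q s x y) y * h y ∂(surface d)
        = (1 / 2) * ∫ y, h y * sphereLaplacian (fun y => q s x y) y ∂(surface d) := by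
          rw [← integral_const_mul]
          congr 1; ext y; ring
      _ = (1 / 2) * ∫ y, q s x y * sphereLaplacian h y ∂(surface d) := by
          rw [hh]; exact congrArg _ hg
      _ = (1 / 2) * ∫ y, -eigenvalue d k * (q s x y * h y) ∂(surface d) := by
          congr 2; ext y
          rw [hh, sphereLaplacian_zonalGegenbauer]; ring
      _ = -(eigenvalue d k / 2) * m s := by
          rw [integral_const_mul]; ring
  set g : ℝ → ℝ := fun s => Real.exp (eigenvalue d k * s / 2) * m s with hg
  have hgd : ∀ s, 0 < s → HasDerivAt g 0 s := by
    intro s hs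
    have h1 : HasDerivAt (fun s : ℝ => eigenvalue d k * s / 2) (eigenvalue d k / 2) s := by
      simpa using ((hasDerivAt_id s).const_mul (eigenvalue d k)).div_const 2
    refine (h1.exp.mul (hderiv s hs)).congr_deriv ?_
    ring
  have hconst : ∀ s, 0 < s → g s = g t := by
    intro s hs
    exact isOpen_Ioi.is_const_of_deriv_eq_zero (convex_Ioi (0 : ℝ)).isPreconnected
      (fun r hr => (hgd r hr).differentiableAt.differentiableWithinAt)
      (fun r hr => (hgd r hr).deriv) hs ht
  have hlim : Tendsto g (𝓝[>] 0) (𝓝 (h x)) := by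
    have h1 := hq.initial x ⟨h, hc⟩
    have h2 : Tendsto (fun s : ℝ => Real.exp (eigenvalue d k * s / 2)) (𝓝[>] 0) (𝓝 1) := by
      have : Continuous fun s : ℝ => Real.exp (eigenvalue d k * s / 2) := by fun_prop
      simpa using (this.tendsto 0).mono_left nhdsWithin_le_nhds
    simpa using h2.mul h1
  have hlim2 : Tendsto g (𝓝[>] 0) (𝓝 (g t)) := by
    refine tendsto_const_nhds.congr' ?_
    filter_upwards [self_mem_nhdsWithin] with s hs using (hconst s hs).symm
  have hfin : g t = h x := tendsto_nhds_unique hlim2 hlim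
  rw [← hfin, hg]
  simp only
  rw [← mul_assoc, ← Real.exp_add]
  have : -(eigenvalue d k * t) / 2 + eigenvalue d k * t / 2 = 0 := by ring
  rw [this, Real.exp_zero, one_mul]

end Moments

/-! ### Expansion of the heat kernel by peak functions -/

section Peak

variable {d : ℕ}

/-- The polynomial `((1 + X) / 2) ^ n`: on the sphere, its zonal function with pole `z` is
nonnegative and concentrates at `z` as `n → ∞`. -/
noncomputable def peakPoly (n : ℕ) : Polynomial ℝ :=
  (Polynomial.C (1 / 2) * (1 + Polynomial.X)) ^ n

lemma zonal_peakPoly (n : ℕ) (z y : Sphere d) :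
    zonal (peakPoly n) z y = ((1 + zonal Polynomial.X z y) / 2) ^ n := by
  simp only [zonal, peakPoly, Polynomial.eval_pow, Polynomial.eval_mul, Polynomial.eval_C,
    Polynomial.eval_add, Polynomial.eval_one, Polynomial.eval_X]
  congr 1
  ring

lemma abs_zonal_X_le_one (z y : Sphere d) : |zonal Polynomial.X z y| ≤ 1 := by
  have h := abs_real_inner_le_norm (z : EuclideanSpace ℝ (Fin (d + 1))) y
  rw [norm_eq_of_mem_sphere, norm_eq_of_mem_sphere, one_mul] at h
  simpa [zonal] using h

lemma zonal_X_self (z : Sphere d) : zonal Polynomial.X z z = 1 := by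
  simp [zonal]

lemma zonal_X_lt_one {z y : Sphere d} (h : y ≠ z) : zonal Polynomial.X z y < 1 := by
  rw [zonal, Polynomial.eval_X, inner_lt_one_iff_real_of_norm_eq_one (norm_eq_of_mem_sphere z)
    (norm_eq_of_mem_sphere y)]
  exact fun h' => h (Subtype.ext h'.symm)

lemma zonal_peakPoly_nonneg (n : ℕ) (z y : Sphere d) : 0 ≤ zonal (peakPoly n) z y := by
  rw [zonal_peakPoly]
  have := (abs_le.1 (abs_zonal_X_le_one z y)).1
  exact pow_nonneg (by linarith) n

lemma integral_peakPoly_pos (n : ℕ) (z : Sphere d) :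
    0 < ∫ y, zonal (peakPoly n) z y ∂(surface d) := by
  refine (continuous_zonal _ z).integral_pos_of_hasCompactSupport_nonneg_nonzero
    (HasCompactSupport.of_compactSpace _) (zonal_peakPoly_nonneg n z) (x := z) ?_
  rw [zonal_peakPoly, zonal_X_self]
  norm_num

/-- The normalized peak functions converge to the Dirac mass at their pole. -/
lemma tendsto_integral_peakPoly (z : Sphere d) {g : Sphere d → ℝ} (hg : Continuous g) :
    Tendsto (fun n : ℕ => (∫ y, zonal (peakPoly n) z y ∂(surface d))⁻¹ *
      ∫ y, zonal (peakPoly n) z y * g y ∂(surface d)) atTop (𝓝 (g z)) := by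
  have h := tendsto_setIntegral_pow_smul_of_unique_maximum_of_isCompact_of_continuousOn
    (μ := surface d) (s := univ) (x₀ := z) (g := g)
    (c := fun y => (1 + zonal Polynomial.X z y) / 2) isCompact_univ
    ((continuous_const.add (continuous_zonal _ z)).div_const 2).continuousOn
    (fun y _ hy => by
      have := zonal_X_lt_one hy
      rw [zonal_X_self]
      linarith)
    (fun y _ => by
      have := (abs_le.1 (abs_zonal_X_le_one z y)).1
      linarith)
    (by rw [zonal_X_self]; norm_num) (by simp) hg.continuousOn
  simpa only [zonal_peakPoly, setIntegral_univ, smul_eq_mul] using h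

/-- The coefficients of the peak polynomials in the Gegenbauer basis. -/
noncomputable def peakCoeff (d : ℕ) (hd : 2 ≤ d) (n : ℕ) : ℕ →₀ ℝ :=
  (exists_eq_sum_gegenbauer (α := ((d : ℝ) - 1) / 2)
    (by have : (2 : ℝ) ≤ d := by exact_mod_cast hd
        linarith) (peakPoly n)).choose

lemma zonal_peakPoly_eq_sum (hd : 2 ≤ d) (n : ℕ) (z y : Sphere d) :
    zonal (peakPoly n) z y = ∑ k ∈ (peakCoeff d hd n).support,
      peakCoeff d hd n k * zonalGegenbauer d k z y := by
  have h := (exists_eq_sum_gegenbauer (α := ((d : ℝ) - 1) / 2)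
    (by have : (2 : ℝ) ≤ d := by exact_mod_cast hd
        linarith) (peakPoly n)).choose_spec
  rw [zonal, h, Finsupp.sum, Polynomial.eval_finsetSum]
  refine Finset.sum_congr rfl fun k _ => ?_
  rw [Polynomial.eval_mul, Polynomial.eval_C]
  rfl

lemma integral_peakPoly_mul_eq_sum (hd : 2 ≤ d) (n : ℕ) (z : Sphere d) {g : Sphere d → ℝ}
    (hg : Continuous g) :
    ∫ y, zonal (peakPoly n) z y * g y ∂(surface d) = ∑ k ∈ (peakCoeff d hd n).support,
      peakCoeff d hd n k * ∫ y, zonalGegenbauer d k z y * g y ∂(surface d) := by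
  simp only [← integral_const_mul]
  refine Eq.trans ?_ (integral_finsetSum _ fun k _ =>
    integrable_surface (continuous_const.mul ((continuous_zonalGegenbauer k z).mul hg)))
  congr 1; ext y
  rw [zonal_peakPoly_eq_sum hd, Finset.sum_mul]
  exact Finset.sum_congr rfl fun k _ => by ring

/-- By orthogonality, a zonal Gegenbauer function of degree `k` sees only the degree `k` component
of a peak function. -/
lemma integral_peakPoly_mul_zonalGegenbauer (hd : 2 ≤ d) (n k : ℕ) (z x : Sphere d) :
    ∫ y, zonal (peakPoly n) z y * zonalGegenbauer d k x y ∂(surface d)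
      = peakCoeff d hd n k *
        ∫ y, zonalGegenbauer d k z y * zonalGegenbauer d k x y ∂(surface d) := by
  rw [integral_peakPoly_mul_eq_sum hd n z (continuous_zonalGegenbauer k x)]
  rw [Finset.sum_eq_single k]
  · intro j _ hj
    rw [integral_zonalGegenbauer_mul_of_ne hd hj, mul_zero]
  · intro hk
    rw [Finsupp.notMem_support_iff.1 hk, zero_mul]

/-- The coefficient `(2k + d - 1) / ((d - 1) A)` of the Gegenbauer expansion of the Dirac mass. -/
noncomputable def diracCoeff (d k : ℕ) : ℝ := (2 * (k : ℝ) + (d : ℝ) - 1) / (((d : ℝ) - 1) * area d)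

lemma diracCoeff_pos (hd : 2 ≤ d) (k : ℕ) : 0 < diracCoeff d k := by
  have h1 : (2 : ℝ) ≤ d := by exact_mod_cast hd
  have h2 : (0 : ℝ) ≤ k := by positivity
  exact div_pos (by linarith) (mul_pos (by linarith) (area_pos d))

lemma zonalGegenbauer_self_pos (hd : 2 ≤ d) (k : ℕ) (z : Sphere d) :
    0 < zonalGegenbauer d k z z := by
  have h1 : (2 : ℝ) ≤ d := by exact_mod_cast hd
  rw [zonalGegenbauer_self]
  exact gegenbauer_eval_one_pos (by linarith) k

lemma diracCoeff_mul_integral_sq (hd : 2 ≤ d) (k : ℕ) (z : Sphere d) :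
    diracCoeff d k * ∫ y, zonalGegenbauer d k z y ^ 2 ∂(surface d) = zonalGegenbauer d k z z := by
  have h1 : (2 : ℝ) ≤ d := by exact_mod_cast hd
  have h := integral_zonalGegenbauer_sq hd k z
  have hA := area_pos d
  have h2 : (d : ℝ) - 1 ≠ 0 := by linarith
  rw [diracCoeff, div_mul_eq_mul_div, h]
  field_simp

lemma integral_sq_pos (hd : 2 ≤ d) (k : ℕ) (z : Sphere d) :
    0 < ∫ y, zonalGegenbauer d k z y ^ 2 ∂(surface d) := by
  have h := diracCoeff_mul_integral_sq hd k z
  have h1 := zonalGegenbauer_self_pos hd k z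
  rw [← h] at h1
  exact pos_of_mul_pos_right h1 (diracCoeff_pos hd k).le

lemma integral_sq_eq (hd : 2 ≤ d) (k : ℕ) (x z : Sphere d) :
    ∫ y, zonalGegenbauer d k x y ^ 2 ∂(surface d)
      = ∫ y, zonalGegenbauer d k z y ^ 2 ∂(surface d) := by
  refine mul_left_cancel₀ (diracCoeff_pos hd k).ne' ?_
  rw [diracCoeff_mul_integral_sq hd, diracCoeff_mul_integral_sq hd, zonalGegenbauer_self,
    zonalGegenbauer_self]

/-- The normalized Gegenbauer coefficients of the peak functions converge to those of the Dirac
mass. -/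
lemma tendsto_peakCoeff (hd : 2 ≤ d) (k : ℕ) (z : Sphere d) :
    Tendsto (fun n : ℕ => (∫ y, zonal (peakPoly n) z y ∂(surface d))⁻¹ * peakCoeff d hd n k)
      atTop (𝓝 (diracCoeff d k)) := by
  have h := tendsto_integral_peakPoly z (continuous_zonalGegenbauer k z)
  simp only [integral_peakPoly_mul_zonalGegenbauer hd, ← pow_two] at h
  have hI := integral_sq_pos hd k z
  have h2 := h.div_const (∫ y, zonalGegenbauer d k z y ^ 2 ∂(surface d))
  rw [← diracCoeff_mul_integral_sq hd k z, mul_div_cancel_right₀ _ hI.ne'] at h2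
  refine h2.congr fun n => ?_
  rw [← mul_assoc, mul_div_cancel_right₀ _ hI.ne']

/-- The Cauchy-Schwarz inequality, for two functions of equal norm. -/
lemma abs_integral_mul_le (hd : 2 ≤ d) (k : ℕ) (z x : Sphere d) :
    |∫ y, zonalGegenbauer d k z y * zonalGegenbauer d k x y ∂(surface d)|
      ≤ ∫ y, zonalGegenbauer d k z y ^ 2 ∂(surface d) := by
  have cz := continuous_zonalGegenbauer k z
  have cx := continuous_zonalGegenbauer k x
  have h : ∫ y, (zonalGegenbauer d k z y ^ 2 + zonalGegenbauer d k x y ^ 2) / 2 ∂(surface d)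
      = ∫ y, zonalGegenbauer d k z y ^ 2 ∂(surface d) := by
    have := integral_add (μ := surface d) (integrable_surface (cz.pow 2))
      (integrable_surface (cx.pow 2))
    rw [integral_div]
    refine (congrArg (· / 2) this).trans ?_
    have e := integral_sq_eq hd k x z
    change (_ + ∫ y, zonalGegenbauer d k x y ^ 2 ∂(surface d)) / 2 = _
    rw [e]
    exact add_self_div_two _
  rw [← h]
  refine (abs_integral_le_integral_abs).trans (integral_mono (integrable_surface (cz.mul cx).abs)
    (integrable_surface (((cz.pow 2).add (cx.pow 2)).div_const 2)) fun y => ?_)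
  simp only [abs_mul]
  nlinarith [sq_nonneg (|zonalGegenbauer d k z y| - |zonalGegenbauer d k x y|),
    sq_abs (zonalGegenbauer d k z y), sq_abs (zonalGegenbauer d k x y)]

/-- A zonal Gegenbauer function takes its largest absolute value at its pole. -/
lemma abs_zonalGegenbauer_le (hd : 2 ≤ d) (k : ℕ) (x z : Sphere d) :
    |zonalGegenbauer d k x z| ≤ (gegenbauer (((d : ℝ) - 1) / 2) k).eval 1 := by
  have h := tendsto_integral_peakPoly z (continuous_zonalGegenbauer k x)
  have h' := (tendsto_peakCoeff hd k z).mul_const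
    (∫ y, zonalGegenbauer d k z y * zonalGegenbauer d k x y ∂(surface d))
  simp only [integral_peakPoly_mul_zonalGegenbauer hd, ← mul_assoc] at h
  rw [← tendsto_nhds_unique h' h, abs_mul, abs_of_pos (diracCoeff_pos hd k),
    ← zonalGegenbauer_self k z, ← diracCoeff_mul_integral_sq hd k z]
  exact mul_le_mul_of_nonneg_left (abs_integral_mul_le hd k z x) (diracCoeff_pos hd k).le

/-- The limit of the normalized coefficients of the peak functions also bounds them, as the peak
functions are nonnegative. -/
lemma abs_peakCoeff_le (hd : 2 ≤ d) (n k : ℕ) (z : Sphere d) :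
    |(∫ y, zonal (peakPoly n) z y ∂(surface d))⁻¹ * peakCoeff d hd n k| ≤ diracCoeff d k := by
  have hN := integral_peakPoly_pos n z
  have hI := integral_sq_pos hd k z
  have h := integral_peakPoly_mul_zonalGegenbauer hd n k z z
  simp only [← pow_two] at h
  have cz := continuous_zonalGegenbauer k z
  have cp := continuous_zonal (peakPoly n) z
  have hle : |∫ y, zonal (peakPoly n) z y * zonalGegenbauer d k z y ∂(surface d)|
      ≤ (∫ y, zonal (peakPoly n) z y ∂(surface d)) * zonalGegenbauer d k z z := by
    rw [← integral_mul_const]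
    refine (abs_integral_le_integral_abs).trans (integral_mono (integrable_surface (cp.mul cz).abs)
      (integrable_surface (cp.mul continuous_const)) fun y => ?_)
    simp only [abs_mul]
    rw [abs_of_nonneg (zonal_peakPoly_nonneg n z y), zonalGegenbauer_self]
    exact mul_le_mul_of_nonneg_left (abs_zonalGegenbauer_le hd k z y)
      (zonal_peakPoly_nonneg n z y)
  rw [h, ← diracCoeff_mul_integral_sq hd k z, abs_mul, abs_of_pos hI, ← mul_assoc] at hle
  have h2 := le_of_mul_le_mul_right hle hI
  rw [abs_mul, abs_inv, abs_of_pos hN, inv_mul_le_iff₀ hN]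
  exact h2

end Peak

section Series

variable {d : ℕ}

/-- The `k`-th term of the Gegenbauer series of the heat kernel. -/
noncomputable def heatTerm (d : ℕ) (t : ℝ) (x y : Sphere d) (k : ℕ) : ℝ :=
  Real.exp (-(eigenvalue d k * t) / 2) * diracCoeff d k * zonalGegenbauer d k x y

/-- An upper bound for the `k`-th term of the Gegenbauer series of the heat kernel. -/
noncomputable def heatBound (d : ℕ) (t : ℝ) (k : ℕ) : ℝ :=
  Real.exp (-(eigenvalue d k * t) / 2) * diracCoeff d k * ((k : ℝ) + 1) ^ d

lemma abs_heatTerm_le (hd : 2 ≤ d) (t : ℝ) (x y : Sphere d) (k : ℕ) :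
    |heatTerm d t x y k| ≤ heatBound d t k := by
  have hb := diracCoeff_pos hd k
  rw [heatTerm, heatBound, abs_mul, abs_of_pos (by positivity)]
  exact mul_le_mul_of_nonneg_left
    ((abs_zonalGegenbauer_le hd k x y).trans (gegenbauer_eval_one_le hd k)) (by positivity)

lemma truncatedKernel_eq_sum (L : ℕ) (t : ℝ) (x y : Sphere d) :
    truncatedKernel d L t x y = ∑ k ∈ Finset.range (L + 1), heatTerm d t x y k := rfl

/-- The polynomial growth of the terms of the Gegenbauer series, apart from the exponential. -/
lemma diracCoeff_mul_pow_le (hd : 2 ≤ d) (k : ℕ) :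
    diracCoeff d k * ((k : ℝ) + 1) ^ d ≤ 2 * d / (((d : ℝ) - 1) * area d)
      * ((k : ℝ) + 1) ^ (d + 1) := by
  have h1 : (2 : ℝ) ≤ d := by exact_mod_cast hd
  have h2 : (0 : ℝ) ≤ k := by positivity
  have hA : 0 < ((d : ℝ) - 1) * area d := mul_pos (by linarith) (area_pos d)
  have h3 : diracCoeff d k ≤ 2 * d / (((d : ℝ) - 1) * area d) * ((k : ℝ) + 1) := by
    rw [diracCoeff, div_mul_eq_mul_div]
    refine div_le_div_of_nonneg_right ?_ hA.le
    nlinarith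
  calc diracCoeff d k * ((k : ℝ) + 1) ^ d
      ≤ (2 * d / (((d : ℝ) - 1) * area d) * ((k : ℝ) + 1)) * ((k : ℝ) + 1) ^ d :=
        mul_le_mul_of_nonneg_right h3 (by positivity)
    _ = _ := by ring

lemma summable_pow_mul_exp_neg (m : ℕ) {r : ℝ} (hr : 0 < r) :
    Summable fun k : ℕ => ((k : ℝ) + 1) ^ m * Real.exp (-(r * k)) := by
  have h := Real.summable_pow_mul_exp_neg_nat_mul m hr
  have h2 := ((summable_nat_add_iff 1).2 h).mul_left (Real.exp r)
  refine h2.congr fun k => ?_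
  push_cast
  rw [show -(r * (k : ℝ)) = r + -r * ((k : ℝ) + 1) by ring, Real.exp_add]
  ring

lemma summable_heatBound (hd : 2 ≤ d) {t : ℝ} (ht : 0 < t) : Summable (heatBound d t) := by
  have h1 : (2 : ℝ) ≤ d := by exact_mod_cast hd
  have hA : 0 < ((d : ℝ) - 1) * area d := mul_pos (by linarith) (area_pos d)
  have hs := (summable_pow_mul_exp_neg (d + 1) (half_pos ht)).mul_left
    (2 * d / (((d : ℝ) - 1) * area d))
  refine Summable.of_nonneg_of_le (fun k => ?_) (fun k => ?_) hs
  · have := diracCoeff_pos hd k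
    unfold heatBound; positivity
  · have h2 : (0 : ℝ) ≤ k := by positivity
    have he : Real.exp (-(eigenvalue d k * t) / 2) ≤ Real.exp (-(t / 2 * k)) := by
      refine Real.exp_le_exp.2 ?_
      have : (k : ℝ) ≤ eigenvalue d k := by
        rcases k.eq_zero_or_pos with rfl | hk
        · simp [eigenvalue]
        · have : (1 : ℝ) ≤ k := by exact_mod_cast hk
          unfold eigenvalue; nlinarith
      nlinarith
    rw [heatBound, mul_assoc]
    calc _ ≤ Real.exp (-(t / 2 * k)) * (2 * d / (((d : ℝ) - 1) * area d)
          * ((k : ℝ) + 1) ^ (d + 1)) :=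
          mul_le_mul he (diracCoeff_mul_pow_le hd k)
            (mul_nonneg (diracCoeff_pos hd k).le (by positivity)) (Real.exp_pos _).le
      _ = _ := by ring

/-- Every fundamental solution is the sum of the Gegenbauer series: testing it against the peak
functions recovers its values, and the expansions of the peak functions converge termwise and
dominatedly. -/
theorem IsFundamentalSolution.eq_tsum {q : ℝ → Sphere d → Sphere d → ℝ}
    (hq : IsFundamentalSolution d q) (hd : 2 ≤ d) {t : ℝ} (ht : 0 < t) (x z : Sphere d) :
    q t x z = ∑' k, heatTerm d t x z k := by
  have hqc : Continuous (fun y => q t x y) := (hq.smooth t ht x).continuous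
  have h1 := tendsto_integral_peakPoly z hqc
  have h2 : Tendsto (fun n : ℕ => ∑' k, ((∫ y, zonal (peakPoly n) z y ∂(surface d))⁻¹ *
      peakCoeff d hd n k) * (Real.exp (-(eigenvalue d k * t) / 2) * zonalGegenbauer d k z x))
      atTop (𝓝 (∑' k, heatTerm d t x z k)) := by
    refine tendsto_tsum_of_dominated_convergence (summable_heatBound hd ht) (fun k => ?_)
      (Eventually.of_forall fun n k => ?_)
    · have h := (tendsto_peakCoeff hd k z).mul_const
        (Real.exp (-(eigenvalue d k * t) / 2) * zonalGegenbauer d k z x)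
      have e : heatTerm d t x z k = diracCoeff d k *
          (Real.exp (-(eigenvalue d k * t) / 2) * zonalGegenbauer d k z x) := by
        rw [heatTerm, zonalGegenbauer_comm]; ring
      rw [e]
      exact h
    · rw [Real.norm_eq_abs, abs_mul, abs_mul (Real.exp _), Real.abs_exp, heatBound]
      calc _ ≤ diracCoeff d k * (Real.exp (-(eigenvalue d k * t) / 2) * ((k : ℝ) + 1) ^ d) := by
            refine mul_le_mul (abs_peakCoeff_le hd n k z) ?_ (by positivity)
              (diracCoeff_pos hd k).le
            exact mul_le_mul_of_nonneg_left
              ((abs_zonalGegenbauer_le hd k z x).trans (gegenbauer_eval_one_le hd k))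
              (Real.exp_pos _).le
        _ = _ := by ring
  refine tendsto_nhds_unique h1 (h2.congr fun n => ?_)
  rw [integral_peakPoly_mul_eq_sum hd n z hqc, Finset.mul_sum,
    tsum_eq_sum (s := (peakCoeff d hd n).support) fun k hk => by
      rw [Finsupp.notMem_support_iff.1 hk, mul_zero, zero_mul]]
  refine Finset.sum_congr rfl fun k _ => ?_
  rw [← hq.integral_mul_zonalGegenbauer k x z ht, mul_assoc]
  congr 3; ext y; ring

end Series

/-! ### Truncation error -/

section Tail

variable {d : ℕ}

/-- The constant of the exponential bound on the truncation error. -/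
noncomputable def tailConst (d : ℕ) : ℝ :=
  2 * d / (((d : ℝ) - 1) * area d) * ∑' k : ℕ, ((k : ℝ) + 1) ^ (d + 1) * Real.exp (-(1 * k))

/-- Once `L t ≥ 4`, the exponents beyond level `L` satisfy `k (k + d - 1) t / 2 ≥ k + L`, so that
the remainder of the series is at most a constant times `exp (-L)`. -/
lemma IsFundamentalSolution.abs_sub_truncatedKernel_le {q : ℝ → Sphere d → Sphere d → ℝ}
    (hq : IsFundamentalSolution d q) (hd : 2 ≤ d) {t : ℝ} (ht : 0 < t) {L : ℕ} (hL : 4 ≤ L * t)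
    (x y : Sphere d) :
    |q t x y - truncatedKernel d L t x y| ≤ tailConst d * Real.exp (-L) := by
  have h1 : (2 : ℝ) ≤ d := by exact_mod_cast hd
  have hA : 0 < ((d : ℝ) - 1) * area d := mul_pos (by linarith) (area_pos d)
  set M := 2 * d / (((d : ℝ) - 1) * area d) with hM
  have hM0 : 0 ≤ M := by positivity
  set w : ℕ → ℝ := fun k => ((k : ℝ) + 1) ^ (d + 1) * Real.exp (-(1 * k)) with hw
  have hws : Summable w := summable_pow_mul_exp_neg (d + 1) one_pos
  have hsum : Summable (heatTerm d t x y) :=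
    Summable.of_norm_bounded (summable_heatBound hd ht) fun k => abs_heatTerm_le hd t x y k
  have hterm : ∀ k : ℕ, ‖heatTerm d t x y (k + (L + 1))‖
      ≤ M * Real.exp (-L) * w (k + (L + 1)) := by
    intro k
    set n := k + (L + 1) with hn
    have hLn : (L : ℝ) ≤ n := by rw [hn]; push_cast; linarith [(Nat.cast_nonneg k : (0:ℝ) ≤ k)]
    have hn0 : (0 : ℝ) ≤ n := by positivity
    have he : Real.exp (-(eigenvalue d n * t) / 2) ≤ Real.exp (-L) * Real.exp (-(1 * n)) := by
      rw [← Real.exp_add]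
      refine Real.exp_le_exp.2 ?_
      -- `k (k + d - 1) t / 2 ≥ k (k t) / 2 ≥ 2 k ≥ L + k` for every degree `k > L`.
      have h4 : 4 ≤ n * t := hL.trans (mul_le_mul_of_nonneg_right hLn ht.le)
      have h5 : (n : ℝ) * (n * t) ≤ eigenvalue d n * t := by
        unfold eigenvalue
        have : 0 ≤ (n : ℝ) * t * (d - 1) := mul_nonneg (by positivity) (by linarith)
        nlinarith
      nlinarith
    refine (abs_heatTerm_le hd t x y n).trans ?_
    rw [heatBound, mul_assoc]
    calc _ ≤ (Real.exp (-L) * Real.exp (-(1 * n))) * (M * ((n : ℝ) + 1) ^ (d + 1)) :=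
          mul_le_mul he (diracCoeff_mul_pow_le hd n)
            (mul_nonneg (diracCoeff_pos hd n).le (by positivity)) (by positivity)
      _ = _ := by rw [hw]; ring
  have hws' : Summable fun k => w (k + (L + 1)) := (summable_nat_add_iff (L + 1)).2 hws
  have hle : ∑' k, w (k + (L + 1)) ≤ ∑' k, w k := by
    rw [← hws.sum_add_tsum_nat_add (L + 1)]
    have : 0 ≤ ∑ k ∈ Finset.range (L + 1), w k :=
      Finset.sum_nonneg fun k _ => by rw [hw]; positivity
    linarith
  rw [hq.eq_tsum hd ht, truncatedKernel_eq_sum, ← hsum.sum_add_tsum_nat_add (L + 1),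
    add_sub_cancel_left, ← Real.norm_eq_abs]
  refine (tsum_of_norm_bounded (hws'.mul_left _).hasSum hterm).trans ?_
  rw [tsum_mul_left, tailConst]
  calc M * Real.exp (-L) * ∑' k, w (k + (L + 1)) ≤ M * Real.exp (-L) * ∑' k, w k :=
        mul_le_mul_of_nonneg_left hle (by positivity)
    _ = _ := by ring

end Tail

lemma tendsto_log_one_div : Tendsto (fun ε : ℝ => Real.log (1 / ε)) (𝓝[>] 0) atTop := by
  simp only [one_div]
  exact Real.tendsto_log_atTop.comp tendsto_inv_nhdsGT_zero

end SphereHeat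

theorem mainTheorem10 (d : ℕ) (hd : 2 ≤ d)
    (ν : ℝ → SphereHeat.Sphere d → SphereHeat.Sphere d → ℝ) (hν : SphereHeat.IsHeatKernel d ν)
    (η : ℝ → ℝ) (hη_pos : ∀ᶠ ε in 𝓝[>] (0 : ℝ), 0 < η ε)
    (hη : SphereHeat.IsSoftO (fun ε => 1 / η ε) (fun ε => Real.log (1 / ε))) :
    ∃ L : ℝ → ℕ,
      (∃ p : ℕ, SphereHeat.IsSoftO (fun ε => (L ε : ℝ)) (fun ε => Real.log (1 / ε) ^ p)) ∧
      ∃ δ : ℝ → ℝ, SphereHeat.IsSoftO δ SphereHeat.zeta ∧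
        ∀ᶠ ε in 𝓝[>] (0 : ℝ), ∀ x y : SphereHeat.Sphere d,
          |ν (η ε) x y - SphereHeat.truncatedKernel d (L ε) (η ε) x y| ≤ δ ε := by
  obtain ⟨m, hm⟩ := hη
  obtain ⟨K, hK0, hK⟩ := hm.exists_pos
  have hlog := SphereHeat.tendsto_log_one_div
  have hM0 : 0 ≤ SphereHeat.tailConst d := by
    have h1 : (2 : ℝ) ≤ d := by exact_mod_cast hd
    have hA : 0 < ((d : ℝ) - 1) * SphereHeat.area d :=
      mul_pos (by linarith) (SphereHeat.area_pos d)
    exact mul_nonneg (by positivity) (tsum_nonneg fun k => by positivity)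
  -- The first summand forces `L η ≥ 4`, the second `exp (-L) ≤ ε`.
  refine ⟨fun ε => ⌈4 * K * Real.log (1 / ε) ^ (m + 1)⌉₊ + ⌈Real.log (1 / ε)⌉₊,
    ⟨m + 1, 0, ?_⟩, fun ε => SphereHeat.tailConst d * ε, ⟨2, ?_⟩, ?_⟩
  · refine Asymptotics.IsBigO.of_bound (4 * K + 3) ?_
    filter_upwards [hlog.eventually_ge_atTop 1] with ε hε
    have hpow : Real.log (1 / ε) ≤ Real.log (1 / ε) ^ (m + 1) :=
      le_self_pow₀ hε (Nat.succ_ne_zero m)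
    have h1 := Nat.ceil_lt_add_one
      (show 0 ≤ 4 * K * Real.log (1 / ε) ^ (m + 1) by positivity)
    have h2 := Nat.ceil_lt_add_one (show 0 ≤ Real.log (1 / ε) by positivity)
    rw [pow_zero, mul_one, Real.norm_of_nonneg (Nat.cast_nonneg _),
      Real.norm_of_nonneg (by positivity)]
    push_cast
    linarith
  · refine Asymptotics.IsBigO.of_bound (SphereHeat.tailConst d) ?_
    filter_upwards [hlog.eventually_gt_atTop 0] with ε hε
    rw [SphereHeat.zeta, div_mul_cancel₀ _ (pow_ne_zero 2 hε.ne'), norm_mul,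
      Real.norm_of_nonneg hM0]
  · filter_upwards [hη_pos, hK.bound, hlog.eventually_ge_atTop 1, self_mem_nhdsWithin]
      with ε hpos hb hε hε0 x y
    have hε0' : (0 : ℝ) < ε := hε0
    set L : ℕ := ⌈4 * K * Real.log (1 / ε) ^ (m + 1)⌉₊ + ⌈Real.log (1 / ε)⌉₊ with hL
    have hLa : 4 * K * Real.log (1 / ε) ^ (m + 1) ≤ (L : ℝ) := by
      rw [hL]; push_cast
      exact (Nat.le_ceil _).trans (le_add_of_nonneg_right (Nat.cast_nonneg _))
    have hLb : Real.log (1 / ε) ≤ (L : ℝ) := by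
      rw [hL]; push_cast
      exact (Nat.le_ceil _).trans (le_add_of_nonneg_left (Nat.cast_nonneg _))
    have hL4 : 4 ≤ (L : ℝ) * η ε := by
      rw [Real.norm_of_nonneg (by positivity), Real.norm_of_nonneg (by positivity),
        div_le_iff₀ hpos] at hb
      calc (4 : ℝ) ≤ 4 * (K * (Real.log (1 / ε) * Real.log (1 / ε) ^ m) * η ε) := by linarith
        _ = 4 * K * Real.log (1 / ε) ^ (m + 1) * η ε := by ring
        _ ≤ L * η ε := mul_le_mul_of_nonneg_right hLa hpos.le
    refine (hν.solution.abs_sub_truncatedKernel_le hd hpos hL4 x y).trans ?_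
    refine mul_le_mul_of_nonneg_left ?_ hM0
    calc Real.exp (-(L : ℝ)) ≤ Real.exp (-Real.log (1 / ε)) :=
          Real.exp_le_exp.2 (neg_le_neg hLb)
      _ = ε := by rw [one_div, Real.log_inv, neg_neg, Real.exp_log hε0']
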